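/- **Corollary (LLN for the two-state general compound Hawkes process).** Let $\lambda>0$ and let $\mu:[0,\infty)\to[0,\infty)$ be a measurable function with $0<\hat\mu:=\int_0^\infty\mu(s)\,ds<1$. On a probability space let $N=(N(t))_{t\ge 0}$ be a one-dimensional Hawkes process: a counting process ($N(0)=0$, nondecreasing right-continuous $\mathbb N$-valued paths with jumps of size $1$) with arrival times $T_1<T_2<\cdots$ whose intensity with respect to its natural filtration is $$\lambda(t)=\lambda+\int_0^t\mu(t-s)\,dN(s)=\lambda+\sum_{k=1}^{N(t)}\mu(t-T_k),$$ i.e. $N(t)-\int_0^t\lambda(s)\,ds$ is a local martingale with respect to that filtration, localized by the arrival times. Let $(X_k)_{k\ge 0}$ be a time-homogeneous Markov chain with state space $\{1,2\}$, independent of $N$, with arbitrary initial law and irreducible transition matrix $P(i,j)=\mathbb P(X_{k+1}=j\mid X_k=i)$, and let $(\pi_1^*,\pi_2^*)$ be its stationary (ergodic) probabilities. Let $S_0$ be a real random variable, let $a_1=a(1)$ and $a_2=a(2)$ be arbitrary real numbers, and let $$S_t=S_0+\sum_{k=1}^{N(t)}a(X_k),\qquad t\ge 0.$$ Then, as $n\to\infty$,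 $$\frac{S_{nt}}{n}\longrightarrow a^*\,\frac{\lambda}{1-\hat\mu}\,t,\qquad a^*:=a_1\pi_1^*+a_2\pi_2^*,$$ weakly in the Skorokhod space $D([0,\infty),\mathbb R)$ with the Skorokhod ($J_1$) topology, as processes in $t\ge 0$. In particular, if $\delta>0$ and the chain takes values in $\{\delta,-\delta\}$, with stationary probabilities $(\pi^*,1-\pi^*)$ for $(\delta,-\delta)$, then with $S_t=S_0+\sum_{k=1}^{N(t)}X_k$ the same convergence holds with $a^*=\delta(2\pi^*-1)$. -/

import Mathlib

open MeasureTheory ProbabilityTheory Filter Topology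
open scoped NNReal Matrix Uniformity

/-! ### The Skorokhod space of càdlàg paths on `[0, ∞)` -/

/-- `f` is right-continuous on `[0, ∞)` and has a (finite) left limit at every point. -/
def IsCadlag (f : ℝ≥0 → ℝ) : Prop :=
  ∀ t, ContinuousWithinAt f (Set.Ici t) t ∧ ∃ l : ℝ, Tendsto f (𝓝[<] t) (𝓝 l)

/-- The space `D([0, ∞), ℝ)` of càdlàg paths. -/
def SkorokhodSpace : Type := {f : ℝ≥0 → ℝ // IsCadlag f}

namespace SkorokhodSpace

/-- `(f, g)` belongs to `entourage T ε` if some time change (increasing bijection of `[0, ∞)`)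
moves each point of `[0, T]` by less than `ε` and carries `f` on `[0, T]` within `ε` of `g`. -/
def entourage (T ε : ℝ≥0) : Set (SkorokhodSpace × SkorokhodSpace) :=
  {q | ∃ τ : ℝ≥0 ≃o ℝ≥0, ∀ t ≤ T, dist (τ t) t < ε ∧ dist (q.2.1 (τ t)) (q.1.1 t) < ε}

theorem entourage_mono {T T' ε ε' : ℝ≥0} (hT : T ≤ T') (hε : ε' ≤ ε) :
    entourage T' ε' ⊆ entourage T ε := by
  rintro q ⟨τ, h⟩
  have hε' : (ε' : ℝ) ≤ ε := by exact_mod_cast hε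
  exact ⟨τ, fun t ht => ⟨(h t (ht.trans hT)).1.trans_le hε', (h t (ht.trans hT)).2.trans_le hε'⟩⟩

/-- The sets `entourage T ε`, for `T ≥ 0` and `ε > 0`, form a filter basis. -/
def entourageBasis : FilterBasis (SkorokhodSpace × SkorokhodSpace) where
  sets := {V | ∃ T ε : ℝ≥0, 0 < ε ∧ V = entourage T ε}
  nonempty := ⟨_, 0, 1, one_pos, rfl⟩
  inter_sets := by
    rintro _ _ ⟨T, ε, hε, rfl⟩ ⟨T', ε', hε', rfl⟩
    exact ⟨_, ⟨max T T', min ε ε', lt_min hε hε', rfl⟩, Set.subset_inter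
      (entourage_mono (le_max_left _ _) (min_le_left _ _))
      (entourage_mono (le_max_right _ _) (min_le_right _ _))⟩

theorem entourage_symm (T ε : ℝ≥0) (_hε : 0 < ε) :
    entourage (T + ε) ε ⊆ Prod.swap ⁻¹' entourage T ε := by
  rintro ⟨f, g⟩ ⟨τ, h⟩
  refine ⟨τ.symm, fun s hs => ?_⟩
  have hle : τ.symm s ≤ T + ε := by
    by_contra hlt
    have h1 : T + ε ≤ τ.symm s := (not_le.mp hlt).le
    have h2 : τ (T + ε) < s := by
      have := τ.strictMono (not_le.mp hlt)
      rwa [τ.apply_symm_apply] at this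
    have h3 := (h (T + ε) le_rfl).1
    rw [NNReal.dist_eq, abs_lt] at h3
    have h4 : (τ (T + ε) : ℝ) < s := by exact_mod_cast h2
    have h5 : (s : ℝ) ≤ T := by exact_mod_cast hs
    have h6 := h3.1
    push_cast at h6
    linarith
  have := h _ hle
  rw [τ.apply_symm_apply] at this
  refine ⟨by rw [dist_comm]; exact this.1, ?_⟩
  change dist (f.1 (τ.symm s)) (g.1 s) < ε
  rw [dist_comm]
  exact this.2

theorem entourage_comp (T ε : ℝ≥0) (_hε : 0 < ε) {f g h : SkorokhodSpace}
    (h₁ : (f, g) ∈ entourage (T + ε) (ε / 2)) (h₂ : (g, h) ∈ entourage (T + ε) (ε / 2)) :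
    (f, h) ∈ entourage T ε := by
  obtain ⟨τ, hτ⟩ := h₁
  obtain ⟨σ, hσ⟩ := h₂
  refine ⟨τ.trans σ, fun t ht => ?_⟩
  have a := hτ t (ht.trans le_self_add)
  have hb : τ t ≤ T + ε := by
    have h1 := a.1
    rw [NNReal.dist_eq, abs_lt] at h1
    have h5 : (t : ℝ) ≤ T := by exact_mod_cast ht
    have h6 := h1.2
    have h7 : (0 : ℝ) ≤ ε := ε.2
    have : (τ t : ℝ) ≤ T + ε := by
      push_cast at h6
      linarith
    exact_mod_cast this
  have b := hσ _ hb
  obtain ⟨a1, a2⟩ := a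
  obtain ⟨b1, b2⟩ := b
  push_cast at a1 a2 b1 b2
  constructor
  · calc dist (σ (τ t)) t ≤ dist (σ (τ t)) (τ t) + dist (τ t) t := dist_triangle _ _ _
      _ < ε := by linarith
  · calc dist (h.1 (σ (τ t))) (f.1 t)
        ≤ dist (h.1 (σ (τ t))) (g.1 (τ t)) + dist (g.1 (τ t)) (f.1 t) := dist_triangle _ _ _
      _ < ε := by linarith

/-- The Skorokhod (J1) topology on `D([0, ∞), ℝ)`, through a uniformity: `f n → f` iff for every
`T` there are time changes `τ n` with `τ n t → t` and `f n (τ n t) → f t`, uniformly for `t ≤ T`. -/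
instance : UniformSpace SkorokhodSpace :=
  UniformSpace.ofCore <| UniformSpace.Core.mkOfBasis entourageBasis
    (by
      rintro _ ⟨T, ε, hε, rfl⟩ f
      exact ⟨OrderIso.refl _, fun t _ => by simpa using hε⟩)
    (by
      rintro _ ⟨T, ε, hε, rfl⟩
      exact ⟨_, ⟨T + ε, ε, hε, rfl⟩, entourage_symm T ε hε⟩)
    (by
      rintro _ ⟨T, ε, hε, rfl⟩
      refine ⟨_, ⟨T + ε, ε / 2, half_pos hε, rfl⟩, ?_⟩
      rintro ⟨f, h⟩ ⟨g, h₁, h₂⟩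
      exact entourage_comp T ε hε h₁ h₂)

instance : MeasurableSpace SkorokhodSpace := borel SkorokhodSpace

instance : BorelSpace SkorokhodSpace := ⟨rfl⟩

/-- A continuous function, as a càdlàg path. -/
def ofContinuous (f : ℝ≥0 → ℝ) (hf : Continuous f) : SkorokhodSpace :=
  ⟨f, fun t => ⟨hf.continuousWithinAt, f t, hf.continuousWithinAt⟩⟩

end SkorokhodSpace

/-! ### Counting processes and Hawkes processes -/

section Processes

variable {Ω : Type*} [MeasurableSpace Ω]

/-- A counting process: `ℕ`-valued, started at `0`, with nondecreasing right-continuous paths all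
of whose jumps have size `1` (`N t ≤ N (t-) + 1`). -/
structure IsCountingProcess (N : ℝ≥0 → Ω → ℕ) : Prop where
  measurable : ∀ t, Measurable (N t)
  zero : ∀ ω, N 0 ω = 0
  mono : ∀ ω, Monotone fun t => N t ω
  rightContinuous : ∀ ω t, ContinuousWithinAt (fun s => N s ω) (Set.Ici t) t
  unitJumps : ∀ ω t, 0 < t → ∃ s < t, N t ω ≤ N s ω + 1

/-- The natural filtration (history) of a counting process. -/
noncomputable def IsCountingProcess.history {N : ℝ≥0 → Ω → ℕ} (hN : IsCountingProcess N) :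
    Filtration ℝ≥0 (inferInstance : MeasurableSpace Ω) :=
  Filtration.natural N fun t => (hN.measurable t).stronglyMeasurable

/-- The `k`-th arrival time `T_k = inf {t | k ≤ N t}`, equal to `⊤` if there is none. -/
noncomputable def arrivalTime (N : ℝ≥0 → Ω → ℕ) (k : ℕ) : Ω → WithTop ℝ≥0 :=
  hittingAfter N (Set.Ici k) 0

/-- The Hawkes intensity
`lam + ∫_0^t μ(t - s) dN(s) = lam + ∑_{k = 1}^{N(t)} μ(t - T_k)`. -/
noncomputable def hawkesIntensity (lam : ℝ) (μ : ℝ → ℝ) (N : ℝ≥0 → Ω → ℕ) (t : ℝ≥0) (ω : Ω) : ℝ :=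
  lam + ∑ k ∈ Finset.Icc 1 (N t ω), μ ((t : ℝ) - ((arrivalTime N k ω).untopA : ℝ≥0))

/-- The integrated intensity `Λ(t) = ∫_0^t λ(s) ds`. -/
noncomputable def hawkesCompensator (lam : ℝ) (μ : ℝ → ℝ) (N : ℝ≥0 → Ω → ℕ) (t : ℝ≥0) (ω : Ω) :
    ℝ :=
  ∫ s in (0 : ℝ)..t, hawkesIntensity lam μ N s.toNNReal ω

/-- `N` is a one-dimensional Hawkes process with background intensity `lam` and excitation function
`μ`: a counting process whose intensity with respect to its natural filtration is
`hawkesIntensity lam μ N`, that is, whose compensator is `Λ`: the process `N - Λ` is a local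
martingale, localized by the arrival times. -/
structure IsHawkesProcess (lam : ℝ) (μ : ℝ → ℝ) (N : ℝ≥0 → Ω → ℕ) (P : Measure Ω) : Prop where
  counting : IsCountingProcess N
  martingale : ∀ k : ℕ, Martingale
    (stoppedProcess (fun t ω => (N t ω : ℝ) - hawkesCompensator lam μ N t ω) (arrivalTime N k))
    counting.history P

/-! ### Markov chains -/

/-- `X 0, X 1, …` is a time-homogeneous Markov chain with transition matrix `p`
(and arbitrary initial law). -/
structure IsMarkovChain {E : Type*} [Fintype E] [DecidableEq E] [MeasurableSpace E]
    (p : Matrix E E ℝ) (X : ℕ → Ω → E) (P : Measure Ω) : Prop where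
  stochastic : p ∈ Matrix.rowStochastic ℝ E
  measurable : ∀ k, Measurable (X k)
  markov : ∀ (k : ℕ) (x : ℕ → E),
    P.real {ω | ∀ i ≤ k + 1, X i ω = x i} = P.real {ω | ∀ i ≤ k, X i ω = x i} * p (x k) (x (k + 1))

/-- `π` is a stationary probability vector of the transition matrix `p`. -/
def IsStationaryDistribution {E : Type*} [Fintype E] (p : Matrix E E ℝ) (π : E → ℝ) : Prop :=
  π ∈ stdSimplex ℝ E ∧ π ᵥ* p = π

/-! ### The compound Hawkes mid-price -/

/-- The mid-price `S_t = S_0 + ∑_{k = 1}^{N(t)} a(X_k)`. -/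
noncomputable def midPrice {E : Type*} (S₀ : Ω → ℝ) (a : E → ℝ) (X : ℕ → Ω → E) (N : ℝ≥0 → Ω → ℕ)
    (t : ℝ≥0) (ω : Ω) : ℝ :=
  S₀ ω + ∑ k ∈ Finset.Icc 1 (N t ω), a (X k ω)

theorem isCadlag_midPrice_div {E : Type*} {N : ℝ≥0 → Ω → ℕ} (hN : IsCountingProcess N)
    (S₀ : Ω → ℝ) (a : E → ℝ) (X : ℕ → Ω → E) (n : ℕ) (ω : Ω) :
    IsCadlag fun t => midPrice S₀ a X N (n * t) ω / n := by
  intro t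
  let g : ℕ → ℝ := fun m => (S₀ ω + ∑ k ∈ Finset.Icc 1 m, a (X k ω)) / n
  have hg : Continuous g := continuous_of_discreteTopology
  have hscale : Monotone fun s : ℝ≥0 => (n : ℝ≥0) * s := fun _ _ h => mul_le_mul_right h _
  have hmono : Monotone fun s : ℝ≥0 => N (n * s) ω := (hN.mono ω).comp hscale
  refine ⟨?_, g _, (hg.tendsto _).comp (hmono.tendsto_nhdsLT t)⟩
  have h1 : ContinuousWithinAt (fun s : ℝ≥0 => (n : ℝ≥0) * s) (Set.Ici t) t :=
    (continuous_const.mul continuous_id).continuousWithinAt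
  have h2 : ContinuousWithinAt (fun s : ℝ≥0 => N (n * s) ω) (Set.Ici t) t :=
    (hN.rightContinuous ω (n * t)).comp h1 fun s hs => hscale hs
  exact (hg.tendsto _).comp h2

/-- The path `t ↦ S_{nt} / n` as an element of the Skorokhod space. -/
noncomputable def scaledMidPrice {E : Type*} {N : ℝ≥0 → Ω → ℕ} (hN : IsCountingProcess N)
    (S₀ : Ω → ℝ) (a : E → ℝ) (X : ℕ → Ω → E) (n : ℕ) (ω : Ω) : SkorokhodSpace :=
  ⟨fun t => midPrice S₀ a X N (n * t) ω / n, isCadlag_midPrice_div hN S₀ a X n ω⟩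

end Processes

/-- The linear path `t ↦ c t` as an element of the Skorokhod space. -/
noncomputable def linearPath (c : ℝ) : SkorokhodSpace :=
  SkorokhodSpace.ofContinuous (fun t => c * t) (continuous_const.mul NNReal.continuous_coe)

/-!
The convergence holds almost surely, locally uniformly in `t`, and hence in distribution for the
Skorokhod topology. It is the composition of two strong laws of large numbers, for the sums
`a (X 1) + ⋯ + a (X m)` and for the counting process `N`. Since `N` is monotone, its law along the
integers is already locally uniform in time (`eventually_forall_abs_comp_div_sub_lt`).

*The chain.* The function `a` minus its stationary mean is an eigenfunction of the `2 × 2`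
transition matrix, with eigenvalue `q = 1 - p 0 1 - p 1 0 ≠ 1`. For an eigenfunction `f` the sums
of `f (X (k + 1)) - q * f (X k)` have orthogonal bounded increments, so that their variances grow
linearly, and they differ from `(1 - q) * ∑ f (X k)` by a bounded amount
(`IsMarkovChain.ae_tendsto_sum_eigenfunction_div_sq`).

*The Hawkes process.* Write `Λ` for the compensator and `θ = ∫ μ`. Stopped at the `k`-th arrival,
`N - Λ` is a bounded martingale on `[0, t]`; its second moment is the expected sum of its squared
increments over arbitrarily fine subdivisions. As `N` has unit jumps and `Λ` is continuous, these
sums give a bound by twice the mean number of jumps (`integral_sq_le_of_martingale_sub`), which is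
at most `lam * t / (1 - θ)`. Letting `k → ∞`, the variance of `N t - Λ t` grows at most linearly in
`t`. Hence `(N t - Λ t) / t → 0` almost surely along the squares, and the explicit form of `Λ`
(`hawkesCompensator_eq`) gives the pathwise bounds
`lam * t + (∫_0^h μ) * N (t - h) ≤ Λ t ≤ lam * t + θ * N t`, which force `N t / t → lam / (1 - θ)`
(`tendsto_of_renewal_bounds`).

In both cases monotonicity, for the chain after adding a constant to `a`, interpolates between
consecutive squares.

*Measurability.* Convergence in distribution includes Borel measurability of the random paths in
the Skorokhod space. They are limits of their discretizations on finer and finer grids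
(`SkorokhodSpace.tendsto_stepPath`), which depend continuously on finitely many values at a time;
the uniformity is countably generated, so that pointwise limits of measurable maps are measurable.
-/

/-! ### Passage times of integer-valued monotone paths -/

/-- A level which a nondecreasing right-continuous integer-valued path reaches at all is reached
from a first time on. -/
theorem exists_forall_le_iff_le {c : ℝ≥0 → ℕ} (hc : Monotone c)
    (hr : ∀ t, ContinuousWithinAt c (Set.Ici t) t) {i : ℕ} {t : ℝ≥0} (h : i ≤ c t) :
    ∃ a, ∀ s, i ≤ c s ↔ a ≤ s := by
  have hbdd : BddBelow {s | i ≤ c s} := OrderBot.bddBelow _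
  refine ⟨sInf {s | i ≤ c s}, fun s => ⟨fun hs => csInf_le hbdd hs, fun hs => ?_⟩⟩
  refine le_trans ?_ (hc hs)
  by_contra hlt
  set a := sInf {s | i ≤ c s}
  have hev : ∀ᶠ s in 𝓝[≥] a, c s = c a := by
    have := hr a
    rw [ContinuousWithinAt, nhds_discrete, tendsto_pure] at this
    exact this
  obtain ⟨b, hab, hb⟩ := mem_nhdsGE_iff_exists_Ico_subset.1 hev
  have : b ≤ a := by
    refine le_csInf ⟨t, h⟩ fun s hs => ?_
    by_contra hsb
    have h1 : c s = c a := hb ⟨csInf_le hbdd hs, not_le.1 hsb⟩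
    exact hlt (h1 ▸ hs)
  exact absurd hab (not_lt.2 this)

/-- The passage times of the levels up to `c T` are finitely many. -/
theorem finite_setOf_passage {c : ℝ≥0 → ℕ} (hc : Monotone c)
    (hr : ∀ t, ContinuousWithinAt c (Set.Ici t) t) (T : ℝ≥0) :
    {a | ∃ i ≤ c T, ∀ s, i ≤ c s ↔ a ≤ s}.Finite := by
  have h : ∀ i : Set.Iic (c T), ∃ a, ∀ s, i.1 ≤ c s ↔ a ≤ s := fun i =>
    exists_forall_le_iff_le hc hr i.2
  choose A hA using h
  refine (Set.finite_range A).subset ?_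
  rintro a ⟨i, hi, ha⟩
  refine ⟨⟨i, hi⟩, le_antisymm ?_ ?_⟩
  · exact (hA ⟨i, hi⟩ a).1 ((ha a).2 le_rfl)
  · exact (ha _).1 ((hA ⟨i, hi⟩ _).2 le_rfl)

theorem Set.Finite.exists_pos_forall_le_dist {α : Type*} [MetricSpace α] {A : Set α}
    (hA : A.Finite) : ∃ η > 0, ∀ a ∈ A, ∀ b ∈ A, a ≠ b → η ≤ dist a b := by
  have h : ∀ᶠ η : ℝ in 𝓝[>] 0, ∀ a ∈ A, ∀ b ∈ A, a ≠ b → η ≤ dist a b := by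
    refine (eventually_all_finite hA).2 fun a _ => (eventually_all_finite hA).2 fun b _ => ?_
    by_cases hab : a = b
    · simp [hab]
    · filter_upwards [Ioo_mem_nhdsGT (dist_pos.2 hab)] with η hη _ using hη.2.le
  obtain ⟨η, h1, h2⟩ := (h.and self_mem_nhdsWithin).exists
  exact ⟨η, h2, h1⟩

/-- Over short time intervals a path with unit jumps increases by at most one. -/
theorem exists_gap {c : ℝ≥0 → ℕ} (hc : Monotone c)
    (hr : ∀ t, ContinuousWithinAt c (Set.Ici t) t) (hu : ∀ t, 0 < t → ∃ s < t, c t ≤ c s + 1)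
    (T : ℝ≥0) :
    ∃ η > 0, ∀ s s' : ℝ≥0, s' ≤ T → (s' : ℝ) - s < η → c s' ≤ c s + 1 := by
  obtain ⟨η, hη, hsep⟩ := (finite_setOf_passage hc hr T).exists_pos_forall_le_dist
  refine ⟨η, hη, fun s s' hs' hlt => ?_⟩
  by_contra hcon
  have hT : c s' ≤ c T := hc hs'
  obtain ⟨a, ha⟩ := exists_forall_le_iff_le hc hr (show c s + 1 ≤ c s' by omega)
  obtain ⟨b, hb⟩ := exists_forall_le_iff_le hc hr (show c s + 2 ≤ c s' by omega)
  have hsa : s < a := by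
    by_contra h
    have := (ha s).2 (not_lt.1 h)
    omega
  have hbs : b ≤ s' := (hb s').1 (by omega)
  have hab : a < b := by
    have h1 : a ≤ b := (ha b).1 (by have := (hb b).2 le_rfl; omega)
    refine lt_of_le_of_ne h1 fun h => ?_
    subst h
    obtain ⟨r, hra, hr⟩ := hu a (lt_of_le_of_lt zero_le hsa)
    have h2 := (hb a).2 le_rfl
    have h3 := (ha r).1 (by omega)
    exact absurd hra (not_lt.2 h3)
  have := hsep b ⟨_, by omega, hb⟩ a ⟨_, by omega, ha⟩ hab.ne'
  have h1 : (b : ℝ) ≤ s' := by exact_mod_cast hbs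
  have h2 : (s : ℝ) < a := by exact_mod_cast hsa
  have h3 : (a : ℝ) < b := by exact_mod_cast hab
  rw [NNReal.dist_eq, abs_of_pos (by linarith)] at this
  linarith

/-! ### Arrival times and stopping -/

section Arrival

variable {Ω : Type*} {N : ℝ≥0 → Ω → ℕ}

theorem arrivalTime_le_iff [MeasurableSpace Ω] (hN : IsCountingProcess N) (k : ℕ) (t : ℝ≥0) (ω : Ω) :
    arrivalTime N k ω ≤ t ↔ k ≤ N t ω := by
  classical
  rw [arrivalTime, hittingAfter_def]
  simp only [zero_le, true_and, Set.mem_Ici]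
  split_ifs with h
  · obtain ⟨u, hu⟩ := h
    obtain ⟨a, ha⟩ := exists_forall_le_iff_le (hN.mono ω) (hN.rightContinuous ω) hu
    simp only [ha]
    change ((sInf (Set.Ici a) : ℝ≥0) : WithTop ℝ≥0) ≤ t ↔ a ≤ t
    rw [csInf_Ici, WithTop.coe_le_coe]
  · push Not at h
    exact iff_of_false (not_le.2 (WithTop.coe_lt_top t)) (not_le.2 (h t))

/-- The time `t` stopped at the `k`-th arrival, `min t T_k`. -/
noncomputable def stopAt (N : ℝ≥0 → Ω → ℕ) (k : ℕ) (t : ℝ≥0) (ω : Ω) : ℝ≥0 :=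
  (min (t : WithTop ℝ≥0) (arrivalTime N k ω)).untopA

theorem stopAt_eq (N : ℝ≥0 → Ω → ℕ) (k : ℕ) (ω : Ω) :
    (∀ t, stopAt N k t ω = t) ∨ ∃ a : ℝ≥0, arrivalTime N k ω = a ∧
      ∀ t, stopAt N k t ω = min t a := by
  cases h : arrivalTime N k ω with
  | top => left; intro t; rw [stopAt, h, min_eq_left le_top]; rfl
  | coe a =>
    right
    refine ⟨a, rfl, fun t => ?_⟩
    rw [stopAt, h, ← WithTop.coe_min]; rfl

theorem stopAt_le (N : ℝ≥0 → Ω → ℕ) (k : ℕ) (t : ℝ≥0) (ω : Ω) : stopAt N k t ω ≤ t := by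
  rcases stopAt_eq N k ω with h | ⟨a, -, h⟩ <;> simp [h]

theorem stopAt_mono (N : ℝ≥0 → Ω → ℕ) (k : ℕ) (ω : Ω) : Monotone fun t => stopAt N k t ω := by
  rcases stopAt_eq N k ω with h | ⟨a, -, h⟩
  · simp only [h]; exact monotone_id
  · simpa [h] using monotone_id.min monotone_const

theorem continuous_stopAt (N : ℝ≥0 → Ω → ℕ) (k : ℕ) (ω : Ω) :
    Continuous fun t => stopAt N k t ω := by
  rcases stopAt_eq N k ω with h | ⟨a, -, h⟩
  · simp only [h]; exact continuous_id
  · simpa [h] using continuous_id.min continuous_const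

theorem stopAt_eq_self [MeasurableSpace Ω] (hN : IsCountingProcess N) {k : ℕ} {t : ℝ≥0} {ω : Ω} (h : N t ω < k) :
    stopAt N k t ω = t := by
  rcases stopAt_eq N k ω with h' | ⟨a, ha, h'⟩
  · exact h' t
  · rw [h', min_eq_left]
    by_contra hat
    have := (arrivalTime_le_iff hN k t ω).1 (by rw [ha]; exact_mod_cast (not_le.1 hat).le)
    omega

/-- Since the jumps have size one, stopping at the `k`-th arrival truncates the count at `k`. -/
theorem apply_stopAt [MeasurableSpace Ω] (hN : IsCountingProcess N) (k : ℕ) (t : ℝ≥0) (ω : Ω) :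
    N (stopAt N k t ω) ω = min (N t ω) k := by
  rcases lt_or_ge (N t ω) k with hlt | hge
  · rw [stopAt_eq_self hN hlt, min_eq_left hlt.le]
  · rw [min_eq_right hge]
    have hT := (arrivalTime_le_iff hN k t ω).2 hge
    obtain ⟨a, ha⟩ := WithTop.ne_top_iff_exists.1 (ne_top_of_le_ne_top WithTop.coe_ne_top hT)
    have hst : stopAt N k t ω = a := by
      rw [stopAt, min_eq_right hT, ← ha]; rfl
    have hiff : ∀ s, k ≤ N s ω ↔ a ≤ s := fun s => by
      rw [← arrivalTime_le_iff hN, ← ha, WithTop.coe_le_coe]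
    rw [hst]
    refine le_antisymm ?_ ((hiff a).2 le_rfl)
    rcases eq_or_ne a 0 with rfl | h0
    · simp [hN.zero ω]
    · obtain ⟨s, hs, h1⟩ := hN.unitJumps ω a (pos_iff_ne_zero.2 h0)
      have : ¬ k ≤ N s ω := fun h => absurd ((hiff s).1 h) (not_le.2 hs)
      omega

end Arrival

/-! ### Convergence and measurability in the Skorokhod space -/

namespace SkorokhodSpace

theorem hasBasis_uniformity : (𝓤 SkorokhodSpace).HasBasis (fun q : ℝ≥0 × ℝ≥0 => 0 < q.2)
    fun q => entourage q.1 q.2 := by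
  refine ⟨fun V => (entourageBasis.hasBasis.mem_iff (t := V)).trans ?_⟩
  constructor
  · rintro ⟨_, ⟨T, ε, hε, rfl⟩, h⟩
    exact ⟨(T, ε), hε, h⟩
  · rintro ⟨⟨T, ε⟩, hε, h⟩
    exact ⟨_, ⟨T, ε, hε, rfl⟩, h⟩

theorem hasBasis_uniformity_nat : (𝓤 SkorokhodSpace).HasBasis (fun _ : ℕ => True)
    fun n => entourage n (1 / (n + 1)) := by
  refine hasBasis_uniformity.to_hasBasis ?_ fun n _ => ⟨(n, 1 / (n + 1)), by positivity, le_rfl⟩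
  rintro ⟨T, ε⟩ hε
  obtain ⟨n, hn⟩ := exists_nat_ge T
  obtain ⟨k, hk⟩ := exists_nat_one_div_lt (K := ℝ≥0) hε
  refine ⟨max n k, trivial, entourage_mono (hn.trans (by exact_mod_cast le_max_left n k)) ?_⟩
  refine le_trans ?_ hk.le
  gcongr
  exact le_max_right n k

instance : (𝓤 SkorokhodSpace).IsCountablyGenerated :=
  hasBasis_uniformity_nat.isCountablyGenerated

theorem tendsto_nhds_iff {ι : Type*} {l : Filter ι} {F : ι → SkorokhodSpace} {f : SkorokhodSpace} :
    Tendsto F l (𝓝 f) ↔ ∀ T ε : ℝ≥0, 0 < ε → ∀ᶠ i in l, ∃ τ : ℝ≥0 ≃o ℝ≥0, ∀ t ≤ T,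
      dist (τ t) t < ε ∧ dist ((F i).1 (τ t)) (f.1 t) < ε := by
  rw [(nhds_basis_uniformity' hasBasis_uniformity).tendsto_right_iff]
  exact ⟨fun h T ε hε => h (T, ε) hε, fun h q hq => h q.1 q.2 hq⟩

/-- Locally uniform convergence implies convergence in the Skorokhod topology. -/
theorem tendsto_nhds_of_locally_uniform {ι : Type*} {l : Filter ι} {F : ι → SkorokhodSpace}
    {f : SkorokhodSpace}
    (h : ∀ T ε : ℝ≥0, 0 < ε → ∀ᶠ i in l, ∀ t ≤ T, dist ((F i).1 t) (f.1 t) < ε) :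
    Tendsto F l (𝓝 f) := by
  refine tendsto_nhds_iff.2 fun T ε hε => (h T ε hε).mono fun i hi => ⟨OrderIso.refl _, ?_⟩
  exact fun t ht => ⟨by simpa using hε, hi t ht⟩

theorem isCadlag_comp_floor (m : ℝ≥0) (hm : 0 < m) (y : ℕ → ℝ) :
    IsCadlag fun t => y ⌊t * m⌋₊ := by
  intro t
  have hy : Continuous y := continuous_of_discreteTopology
  have hmono : Monotone fun s : ℝ≥0 => ⌊s * m⌋₊ := fun s s' h =>
    Nat.floor_mono (by gcongr)
  refine ⟨?_, y _, (hy.tendsto _).comp (hmono.tendsto_nhdsLT t)⟩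
  have hlt : t < (⌊t * m⌋₊ + 1) / m := by
    rw [lt_div_iff₀ hm]
    exact Nat.lt_floor_add_one _
  refine tendsto_const_nhds.congr' ?_
  filter_upwards [Ico_mem_nhdsGE hlt] with s hs
  have : ⌊s * m⌋₊ = ⌊t * m⌋₊ := by
    refine le_antisymm ?_ (hmono hs.1)
    have h2 := (lt_div_iff₀ hm).1 hs.2
    have : ⌊s * m⌋₊ < ⌊t * m⌋₊ + 1 := (Nat.floor_lt zero_le).2 (by exact_mod_cast h2)
    omega
  simp only [this]

/-- The càdlàg step path with value `y j` on `[j / m, (j + 1) / m)`. -/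
noncomputable def stepPath (m : ℝ≥0) (hm : 0 < m) (y : ℕ → ℝ) : SkorokhodSpace :=
  ⟨fun t => y ⌊t * m⌋₊, isCadlag_comp_floor m hm y⟩

theorem continuous_stepPath (m : ℝ≥0) (hm : 0 < m) : Continuous (stepPath m hm) := by
  refine continuous_iff_continuousAt.2 fun y => tendsto_nhds_of_locally_uniform fun T ε hε => ?_
  have h : ∀ᶠ y' in 𝓝 y, ∀ j ∈ Set.Iic ⌊T * m⌋₊, dist (y' j) (y j) < ε :=
    (eventually_all_finite (Set.finite_Iic _)).2 fun j _ =>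
      (continuous_apply j).continuousAt.eventually (Metric.ball_mem_nhds (y j) hε)
  filter_upwards [h] with y' hy' t ht
  exact hy' _ (Nat.floor_mono (by gcongr))

/-- Finitely many points of `[0, ∞)`, the origin among them, can be displaced by a time change
which is uniformly close to the identity, if each of them moves little enough. -/
theorem exists_timeChange {A : Set ℝ≥0} (hA : A.Finite) (h0 : 0 ∈ A) {ε : ℝ} (hε : 0 < ε) :
    ∃ δ > 0, ∀ d : ℝ≥0 → ℝ≥0, d 0 = 0 → (∀ a ∈ A, |(d a : ℝ) - a| ≤ δ) →
      ∃ τ : ℝ≥0 ≃o ℝ≥0, (∀ a ∈ A, τ a = d a) ∧ ∀ t, dist (τ t) t < ε := by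
  obtain ⟨η, hη, hsep⟩ := hA.exists_pos_forall_le_dist
  have hδ : 0 < min (ε / 2) (η / 4) := by positivity
  refine ⟨min (ε / 2) (η / 4), hδ, fun d hd0 hd => ?_⟩
  set δ := min (ε / 2) (η / 4) with hδdef
  -- The displacement is `1/2`-Lipschitz on `A`; it is extended and truncated at height `δ`, and
  -- adding a `1/2`-Lipschitz function to the identity keeps it strictly increasing.
  have hlip : LipschitzOnWith (1 / 2) (fun a : ℝ≥0 => (d a : ℝ) - a) A := by
    refine LipschitzOnWith.of_dist_le_mul fun a ha b hb => ?_
    rcases eq_or_ne a b with rfl | hab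
    · simp
    · have h1 := hsep a ha b hb hab
      have h2 := abs_le.1 (hd a ha)
      have h3 := abs_le.1 (hd b hb)
      have h4 : δ ≤ η / 4 := min_le_right _ _
      rw [Real.dist_eq]
      have h5 : |((d a : ℝ) - a) - (d b - b)| ≤ 2 * δ := abs_le.2 ⟨by linarith, by linarith⟩
      push_cast
      linarith
  obtain ⟨g, hg, hge⟩ := hlip.extend_real
  have hG : LipschitzWith (1 / 2) fun t => max (-δ) (min δ (g t)) :=
    (hg.const_min δ).const_max (-δ)
  set G : ℝ≥0 → ℝ := fun t => max (-δ) (min δ (g t)) with hGdef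
  have hGA : ∀ a ∈ A, G a = (d a : ℝ) - a := fun a ha => by
    have h2 := abs_le.1 (hd a ha)
    simp only [hGdef, ← hge ha]
    rw [min_eq_right h2.2, max_eq_right h2.1]
  have hGδ : ∀ t, |G t| ≤ δ := fun t =>
    abs_le.2 ⟨le_max_left _ _, max_le (by linarith) (min_le_left _ _)⟩
  have hG0 : G 0 = 0 := by simp [hGA 0 h0, hd0]
  have hinc : ∀ s t : ℝ≥0, s ≤ t → (s : ℝ) + G s + ((t : ℝ) - s) / 2 ≤ t + G t := by
    intro s t hst
    have h1 := hG.dist_le_mul s t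
    have h2 : (s : ℝ) ≤ t := by exact_mod_cast hst
    rw [Real.dist_eq, NNReal.dist_eq, abs_sub_comm (s : ℝ), abs_of_nonneg (sub_nonneg.2 h2)] at h1
    have := (abs_le.1 h1).2
    push_cast at this
    linarith
  have hnn : ∀ t : ℝ≥0, 0 ≤ (t : ℝ) + G t := fun t => by
    have := hinc 0 t zero_le
    simp only [NNReal.coe_zero, hG0] at this
    linarith [NNReal.coe_nonneg t]
  have hmono : StrictMono fun t : ℝ≥0 => (⟨(t : ℝ) + G t, hnn t⟩ : ℝ≥0) := by
    intro s t hst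
    have h1 := hinc s t hst.le
    have h2 : (s : ℝ) < t := by exact_mod_cast hst
    exact Subtype.mk_lt_mk.2 (by linarith)
  have hcont : Continuous fun t : ℝ≥0 => (⟨(t : ℝ) + G t, hnn t⟩ : ℝ≥0) :=
    (NNReal.continuous_coe.add hG.continuous).subtype_mk _
  have hsurj : Function.Surjective fun t : ℝ≥0 => (⟨(t : ℝ) + G t, hnn t⟩ : ℝ≥0) := by
    intro (y : ℝ≥0)
    refine mem_range_of_exists_le_of_exists_ge hcont ⟨0, ?_⟩ ⟨y + ⟨δ, hδ.le⟩, ?_⟩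
    · exact Subtype.mk_le_mk.2 (by simp [hG0])
    · have := (abs_le.1 (hGδ (y + ⟨δ, hδ.le⟩))).1
      refine Subtype.mk_le_mk.2 ?_
      change (y : ℝ) ≤ y + δ + _
      linarith
  refine ⟨hmono.orderIsoOfSurjective _ hsurj, fun a ha => ?_, fun t => ?_⟩
  · refine NNReal.eq ?_
    change (a : ℝ) + G a = d a
    rw [hGA a ha]
    ring
  · rw [NNReal.dist_eq]
    change |(t : ℝ) + G t - t| < ε
    rw [add_sub_cancel_left]
    have : δ ≤ ε / 2 := min_le_left _ _
    linarith [hGδ t]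

/-- A path `g ∘ c`, with `c` a nondecreasing right-continuous integer-valued path, is the limit of
its discretizations: the time change moves each jump time `a` to the next grid point
`⌈a m⌉ / m`. -/
theorem tendsto_stepPath {f : SkorokhodSpace} {c : ℝ≥0 → ℕ} {g : ℕ → ℝ} (hc : Monotone c)
    (hr : ∀ t, ContinuousWithinAt c (Set.Ici t) t) (hf : ∀ t, f.1 t = g (c t)) :
    Tendsto (fun m : ℕ => stepPath (m + 1) (by positivity) fun j => f.1 (j / (m + 1)))
      atTop (𝓝 f) := by
  refine tendsto_nhds_iff.2 fun T ε hε => ?_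
  set A : Set ℝ≥0 := {a | ∃ i ≤ c (T + 1), ∀ s, i ≤ c s ↔ a ≤ s} with hAdef
  have h0 : (0 : ℝ≥0) ∈ A := ⟨0, zero_le, by simp⟩
  obtain ⟨δ, hδ, H⟩ := exists_timeChange (finite_setOf_passage hc hr (T + 1)) h0
    (ε := min ε 1) (by positivity)
  obtain ⟨m₀, hm₀⟩ := exists_nat_one_div_lt hδ
  filter_upwards [eventually_ge_atTop m₀] with m hm
  have hM : (0 : ℝ≥0) < m + 1 := by positivity
  have hMR : (0 : ℝ) < m + 1 := by positivity
  obtain ⟨τ, hτA, hτ⟩ := H (fun a => ⌈a * (m + 1)⌉₊ / (m + 1)) (by simp) (by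
    intro a _
    have h1 : a * (m + 1) ≤ ⌈a * (m + 1)⌉₊ := Nat.le_ceil _
    have h2 : (⌈a * (m + 1)⌉₊ : ℝ≥0) < a * (m + 1) + 1 := Nat.ceil_lt_add_one zero_le
    have h1' : (a : ℝ) * (m + 1) ≤ (⌈a * (m + 1)⌉₊ : ℕ) := by exact_mod_cast h1
    have h2' : ((⌈a * (m + 1)⌉₊ : ℕ) : ℝ) < a * (m + 1) + 1 := by exact_mod_cast h2
    push_cast
    have h3 : (1 : ℝ) / (m + 1) ≤ δ := by
      refine le_trans ?_ hm₀.le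
      gcongr
    have h4 : (a : ℝ) ≤ (⌈a * (m + 1)⌉₊ : ℕ) / ((m : ℝ) + 1) := (le_div_iff₀ hMR).2 h1'
    have h5 : (⌈a * (m + 1)⌉₊ : ℕ) / ((m : ℝ) + 1) ≤ a + 1 / (m + 1) := by
      rw [div_le_iff₀ hMR, add_mul, one_div, inv_mul_cancel₀ hMR.ne']
      exact h2'.le
    rw [abs_of_nonneg (by linarith)]
    linarith)
  refine ⟨τ, fun t ht => ⟨(hτ t).trans_le (min_le_left _ _), ?_⟩⟩
  set r : ℝ≥0 := ⌊τ t * (m + 1)⌋₊ / (m + 1) with hrdef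
  have hrτ : r ≤ τ t := (div_le_iff₀ hM).2 (Nat.floor_le zero_le)
  have hkey : c r = c t := by
    apply le_antisymm
    · by_contra hcon
      have hτT : τ t ≤ T + 1 := by
        have h1 := (hτ t).trans_le (min_le_right _ _)
        rw [NNReal.dist_eq] at h1
        have h2 := (abs_lt.1 h1).2
        have h3 : (t : ℝ) ≤ T := by exact_mod_cast ht
        have : (τ t : ℝ) ≤ T + 1 := by linarith
        exact_mod_cast this
      have h1 : c t + 1 ≤ c r := by omega
      obtain ⟨b, hb⟩ := exists_forall_le_iff_le hc hr h1
      have hbA : b ∈ A := ⟨_, h1.trans (hc (hrτ.trans hτT)), hb⟩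
      have hbr : b ≤ r := (hb r).1 h1
      have h2 : ⌈b * (m + 1)⌉₊ ≤ ⌊τ t * (m + 1)⌋₊ := Nat.ceil_le.2 ((le_div_iff₀ hM).1 hbr)
      have h3 : τ b ≤ r := by
        rw [hτA b hbA, hrdef]
        gcongr
      have h4 : b ≤ t := τ.le_iff_le.1 (h3.trans hrτ)
      have := (hb t).2 h4
      omega
    · obtain ⟨a, ha⟩ := exists_forall_le_iff_le hc hr (le_refl (c t))
      have hat : a ≤ t := (ha t).1 le_rfl
      have haA : a ∈ A := ⟨_, hc (ht.trans le_self_add), ha⟩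
      have h1 : τ a ≤ τ t := τ.monotone hat
      rw [hτA a haA, div_le_iff₀ hM] at h1
      have h2 : ⌈a * (m + 1)⌉₊ ≤ ⌊τ t * (m + 1)⌋₊ := Nat.le_floor h1
      refine (ha r).2 ?_
      rw [hrdef, le_div_iff₀ hM]
      exact (Nat.le_ceil _).trans (by exact_mod_cast h2)
  have : (stepPath (m + 1) (by positivity) fun j => f.1 (j / (m + 1))).1 (τ t) = f.1 t := by
    change f.1 r = f.1 t
    rw [hf, hf, hkey]
  rw [this, dist_self]
  exact hε

/-- A random step path is Borel measurable as soon as its values at fixed times are. -/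
theorem measurable_of_measurable_apply {Ω : Type*} [MeasurableSpace Ω] {F : Ω → SkorokhodSpace}
    (hmeas : ∀ t, Measurable fun ω => (F ω).1 t)
    (hF : ∀ ω, ∃ (c : ℝ≥0 → ℕ) (g : ℕ → ℝ), Monotone c ∧
      (∀ t, ContinuousWithinAt c (Set.Ici t) t) ∧ ∀ t, (F ω).1 t = g (c t)) :
    Measurable F := by
  refine measurable_of_tendsto_metrizable (f := fun (m : ℕ) ω =>
    stepPath (m + 1) (by positivity) fun j => (F ω).1 (j / (m + 1))) (fun m => ?_) ?_
  · exact (continuous_stepPath _ _).measurable.comp (measurable_pi_lambda _ fun j => hmeas _)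
  · refine tendsto_pi_nhds.2 fun ω => ?_
    obtain ⟨c, g, hc, hr, hf⟩ := hF ω
    exact tendsto_stepPath hc hr hf

end SkorokhodSpace

/-! ### The compensator of a Hawkes process -/

/-- The cumulative excitation `∫_0^u μ`, equal to `0` for `u ≤ 0`: only the values of `μ` on
`(0, ∞)` enter. -/
noncomputable def cumulativeExcitation (μ : ℝ → ℝ) (u : ℝ) : ℝ :=
  ∫ x in (0 : ℝ)..u, (Set.Ioi 0).indicator μ x

section CumulativeExcitation

variable {μ : ℝ → ℝ}

theorem integrable_indicator_Ioi (hμ_int : IntegrableOn μ (Set.Ioi 0)) :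
    Integrable ((Set.Ioi 0).indicator μ) :=
  (integrable_indicator_iff measurableSet_Ioi).2 hμ_int

theorem cumulativeExcitation_of_nonpos (μ : ℝ → ℝ) {u : ℝ} (hu : u ≤ 0) :
    cumulativeExcitation μ u = 0 := by
  refine intervalIntegral.integral_zero_ae (Eventually.of_forall fun x hx => ?_)
  rw [Set.uIoc_of_ge hu] at hx
  exact Set.indicator_of_notMem (not_lt.2 hx.2) _

theorem cumulativeExcitation_sub (hμ_int : IntegrableOn μ (Set.Ioi 0)) (u v : ℝ) :
    cumulativeExcitation μ v - cumulativeExcitation μ u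
      = ∫ x in u..v, (Set.Ioi 0).indicator μ x :=
  intervalIntegral.integral_interval_sub_left
    (integrable_indicator_Ioi hμ_int).intervalIntegrable
    (integrable_indicator_Ioi hμ_int).intervalIntegrable

theorem monotone_cumulativeExcitation (hμ_nonneg : ∀ t, 0 ≤ t → 0 ≤ μ t)
    (hμ_int : IntegrableOn μ (Set.Ioi 0)) : Monotone (cumulativeExcitation μ) := by
  intro u v huv
  rw [← sub_nonneg, cumulativeExcitation_sub hμ_int]
  refine intervalIntegral.integral_nonneg huv fun x _ => ?_
  exact Set.indicator_nonneg (fun x hx => hμ_nonneg x (le_of_lt hx)) x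

theorem continuous_cumulativeExcitation (hμ_int : IntegrableOn μ (Set.Ioi 0)) :
    Continuous (cumulativeExcitation μ) :=
  intervalIntegral.continuous_primitive
    (fun _ _ => (integrable_indicator_Ioi hμ_int).intervalIntegrable) 0

theorem tendsto_cumulativeExcitation (hμ_int : IntegrableOn μ (Set.Ioi 0)) :
    Tendsto (cumulativeExcitation μ) atTop (𝓝 (∫ s in Set.Ioi 0, μ s)) := by
  have h := intervalIntegral_tendsto_integral_Ioi 0
    (integrable_indicator_Ioi hμ_int).integrableOn tendsto_id
  rwa [setIntegral_indicator measurableSet_Ioi, Set.inter_self] at h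

theorem cumulativeExcitation_le (hμ_nonneg : ∀ t, 0 ≤ t → 0 ≤ μ t)
    (hμ_int : IntegrableOn μ (Set.Ioi 0)) (u : ℝ) :
    cumulativeExcitation μ u ≤ ∫ s in Set.Ioi 0, μ s :=
  (monotone_cumulativeExcitation hμ_nonneg hμ_int).ge_of_tendsto
    (tendsto_cumulativeExcitation hμ_int) u

theorem cumulativeExcitation_nonneg (hμ_nonneg : ∀ t, 0 ≤ t → 0 ≤ μ t)
    (hμ_int : IntegrableOn μ (Set.Ioi 0)) (u : ℝ) : 0 ≤ cumulativeExcitation μ u := by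
  rcases le_total u 0 with hu | hu
  · exact (cumulativeExcitation_of_nonpos μ hu).ge
  · rw [← cumulativeExcitation_of_nonpos μ le_rfl]
    exact monotone_cumulativeExcitation hμ_nonneg hμ_int hu

end CumulativeExcitation

section Compensator

variable {Ω : Type*} {N : ℝ≥0 → Ω → ℕ} {lam : ℝ} {μ : ℝ → ℝ}

theorem untopA_arrivalTime_le_iff [MeasurableSpace Ω] (hN : IsCountingProcess N) {k : ℕ} {T : ℝ≥0} {ω : Ω}
    (hk : k ≤ N T ω) (s : ℝ≥0) : (arrivalTime N k ω).untopA ≤ s ↔ k ≤ N s ω := by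
  have hT := (arrivalTime_le_iff hN k T ω).2 hk
  rw [WithTop.untopA_le_iff (ne_top_of_le_ne_top WithTop.coe_ne_top hT), arrivalTime_le_iff hN]

/-- The compensator is explicit: each arrival before `t` contributes the excitation accumulated
since then. -/
theorem hawkesCompensator_eq [MeasurableSpace Ω] (hN : IsCountingProcess N) (hμ_int : IntegrableOn μ (Set.Ioi 0))
    {t T : ℝ≥0} (htT : t ≤ T) (ω : Ω) :
    hawkesCompensator lam μ N t ω = lam * t + ∑ k ∈ Finset.Icc 1 (N T ω),
      cumulativeExcitation μ ((t : ℝ) - ((arrivalTime N k ω).untopA : ℝ≥0)) := by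
  set A : ℕ → ℝ := fun k => ((arrivalTime N k ω).untopA : ℝ≥0) with hA
  have hμi := integrable_indicator_Ioi hμ_int
  have hcongr : hawkesCompensator lam μ N t ω = ∫ s in (0 : ℝ)..t,
      (lam + ∑ k ∈ Finset.Icc 1 (N T ω), (Set.Ioi 0).indicator μ (s - A k)) := by
    refine intervalIntegral.integral_congr_ae ?_
    -- At an arrival time the two integrands may differ, by `μ 0`.
    have hfin : ((Finset.Icc 1 (N T ω)).image A : Set ℝ).Finite := Finset.finite_toSet _
    filter_upwards [hfin.countable.ae_notMem volume] with s hs hs0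
    rw [Set.uIoc_of_le (NNReal.coe_nonneg t)] at hs0
    have hs' : ((s.toNNReal : ℝ≥0) : ℝ) = s := Real.coe_toNNReal s hs0.1.le
    have hsT : s.toNNReal ≤ T := by
      refine le_trans ?_ htT
      exact Real.toNNReal_le_iff_le_coe.2 hs0.2
    rw [hawkesIntensity, hs']
    congr 1
    have hsub : Finset.Icc 1 (N s.toNNReal ω) ⊆ Finset.Icc 1 (N T ω) :=
      Finset.Icc_subset_Icc_right (hN.mono ω hsT)
    have hle : ∀ k ∈ Finset.Icc 1 (N T ω), (A k ≤ s ↔ k ≤ N s.toNNReal ω) := fun k hk => by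
      rw [← untopA_arrivalTime_le_iff hN (Finset.mem_Icc.1 hk).2 s.toNNReal, ← NNReal.coe_le_coe,
        hs']
    rw [← Finset.sum_subset hsub]
    · refine Finset.sum_congr rfl fun k hk => ?_
      have h1 : A k ≤ s := (hle k (hsub hk)).2 (Finset.mem_Icc.1 hk).2
      have h2 : A k ≠ s := fun h => hs (by
        rw [Finset.mem_coe, ← h]
        exact Finset.mem_image_of_mem A (hsub hk))
      exact (Set.indicator_of_mem (Set.mem_Ioi.2 (sub_pos.2 (lt_of_le_of_ne h1 h2))) μ).symm
    · intro k hk hk'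
      have h1 : ¬ A k ≤ s := fun h =>
        hk' (Finset.mem_Icc.2 ⟨(Finset.mem_Icc.1 hk).1, (hle k hk).1 h⟩)
      exact Set.indicator_of_notMem (fun h => h1 (sub_pos.1 h).le) _
  have hsum : IntervalIntegrable
      (fun s => ∑ k ∈ Finset.Icc 1 (N T ω), (Set.Ioi 0).indicator μ (s - A k)) volume 0 t :=
    (integrable_finsetSum _ fun k _ => hμi.comp_sub_right (A k)).intervalIntegrable
  rw [hcongr, intervalIntegral.integral_add intervalIntegrable_const hsum, intervalIntegral.integral_finsetSum
      fun k _ => (hμi.comp_sub_right (A k)).intervalIntegrable]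
  congr 1
  · simp [mul_comm]
  · refine Finset.sum_congr rfl fun k _ => ?_
    rw [intervalIntegral.integral_comp_sub_right, ← cumulativeExcitation_sub hμ_int, zero_sub,
      cumulativeExcitation_of_nonpos μ (neg_nonpos.2 (NNReal.coe_nonneg _)), sub_zero]

theorem hawkesCompensator_zero (lam : ℝ) (μ : ℝ → ℝ) (N : ℝ≥0 → Ω → ℕ) (ω : Ω) :
    hawkesCompensator lam μ N 0 ω = 0 := by
  simp [hawkesCompensator]

theorem monotone_hawkesCompensator [MeasurableSpace Ω] (hN : IsCountingProcess N) (hlam : 0 ≤ lam)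
    (hμ_nonneg : ∀ t, 0 ≤ t → 0 ≤ μ t) (hμ_int : IntegrableOn μ (Set.Ioi 0)) (ω : Ω) :
    Monotone fun t => hawkesCompensator lam μ N t ω := by
  intro s t hst
  have h : (s : ℝ) ≤ t := by exact_mod_cast hst
  simp only [hawkesCompensator_eq hN hμ_int hst, hawkesCompensator_eq hN hμ_int (le_refl t)]
  gcongr with k
  exact monotone_cumulativeExcitation hμ_nonneg hμ_int (by linarith)

theorem continuous_hawkesCompensator [MeasurableSpace Ω] (hN : IsCountingProcess N)
    (hμ_int : IntegrableOn μ (Set.Ioi 0)) (ω : Ω) :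
    Continuous fun t => hawkesCompensator lam μ N t ω := by
  refine continuous_iff_continuousAt.2 fun t => ?_
  have hev : (fun s : ℝ≥0 => lam * s + ∑ k ∈ Finset.Icc 1 (N (t + 1) ω),
      cumulativeExcitation μ ((s : ℝ) - ((arrivalTime N k ω).untopA : ℝ≥0)))
      =ᶠ[𝓝 t] fun s => hawkesCompensator lam μ N s ω := by
    filter_upwards [Iio_mem_nhds (lt_add_one t)] with s hs
    exact (hawkesCompensator_eq hN hμ_int (le_of_lt hs) ω).symm
  refine ContinuousAt.congr (Continuous.continuousAt ?_) hev
  refine (continuous_const.mul NNReal.continuous_coe).add (continuous_finsetSum _ fun k _ => ?_)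
  exact (continuous_cumulativeExcitation hμ_int).comp (NNReal.continuous_coe.sub continuous_const)

theorem hawkesCompensator_le [MeasurableSpace Ω] (hN : IsCountingProcess N) (hμ_nonneg : ∀ t, 0 ≤ t → 0 ≤ μ t)
    (hμ_int : IntegrableOn μ (Set.Ioi 0)) (t : ℝ≥0) (ω : Ω) :
    hawkesCompensator lam μ N t ω ≤ lam * t + (∫ s in Set.Ioi 0, μ s) * N t ω := by
  rw [hawkesCompensator_eq hN hμ_int (le_refl t)]
  gcongr
  refine (Finset.sum_le_sum fun k _ => cumulativeExcitation_le hμ_nonneg hμ_int _).trans ?_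
  simp [mul_comm]

theorem le_hawkesCompensator [MeasurableSpace Ω] (hN : IsCountingProcess N) (hμ_nonneg : ∀ t, 0 ≤ t → 0 ≤ μ t)
    (hμ_int : IntegrableOn μ (Set.Ioi 0)) {s t h : ℝ≥0} (hst : s + h ≤ t) (ω : Ω) :
    lam * t + cumulativeExcitation μ h * N s ω ≤ hawkesCompensator lam μ N t ω := by
  rw [hawkesCompensator_eq hN hμ_int (le_refl t)]
  gcongr
  have hs : s ≤ t := le_self_add.trans hst
  have hsub : Finset.Icc 1 (N s ω) ⊆ Finset.Icc 1 (N t ω) :=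
    Finset.Icc_subset_Icc_right (hN.mono ω hs)
  calc cumulativeExcitation μ h * N s ω
      = ∑ k ∈ Finset.Icc 1 (N s ω), cumulativeExcitation μ h := by simp [mul_comm]
    _ ≤ ∑ k ∈ Finset.Icc 1 (N s ω),
        cumulativeExcitation μ ((t : ℝ) - ((arrivalTime N k ω).untopA : ℝ≥0)) := by
      refine Finset.sum_le_sum fun k hk => monotone_cumulativeExcitation hμ_nonneg hμ_int ?_
      have h1 := (untopA_arrivalTime_le_iff hN (Finset.mem_Icc.1 hk).2 s).2 (Finset.mem_Icc.1 hk).2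
      have h1' : (((arrivalTime N k ω).untopA : ℝ≥0) : ℝ) ≤ s := by exact_mod_cast h1
      have h2 : (s : ℝ) + h ≤ t := by exact_mod_cast hst
      linarith
    _ ≤ _ := Finset.sum_le_sum_of_subset_of_nonneg hsub fun k _ _ =>
      cumulativeExcitation_nonneg hμ_nonneg hμ_int _

end Compensator

/-! ### Second moments of compensated counting processes -/

theorem sum_range_sub_sq_le {f : ℕ → ℝ} {ε : ℝ} {m : ℕ}
    (hf : ∀ i < m, f i ≤ f (i + 1)) (hε : ∀ i < m, f (i + 1) - f i ≤ ε) :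
    ∑ i ∈ Finset.range m, (f (i + 1) - f i) ^ 2 ≤ ε * (f m - f 0) := by
  rw [← Finset.sum_range_sub, Finset.mul_sum]
  refine Finset.sum_le_sum fun i hi => ?_
  have h1 := hf i (Finset.mem_range.1 hi)
  have h2 := hε i (Finset.mem_range.1 hi)
  rw [sq]
  exact mul_le_mul_of_nonneg_right h2 (by linarith)

/-- The `i`-th point of the subdivision of `[0, t]` into `m + 1` intervals of equal length. -/
noncomputable def gridPoint (t : ℝ≥0) (m i : ℕ) : ℝ≥0 := t * i / (m + 1)

theorem gridPoint_zero (t : ℝ≥0) (m : ℕ) : gridPoint t m 0 = 0 := by simp [gridPoint]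

theorem gridPoint_last (t : ℝ≥0) (m : ℕ) : gridPoint t m (m + 1) = t := by
  rw [gridPoint]
  push_cast
  exact mul_div_cancel_right₀ t (by positivity)

theorem monotone_gridPoint (t : ℝ≥0) (m : ℕ) : Monotone (gridPoint t m) := by
  intro i j hij
  rw [gridPoint, gridPoint]
  gcongr

theorem gridPoint_succ_sub (t : ℝ≥0) (m i : ℕ) :
    (gridPoint t m (i + 1) : ℝ) - gridPoint t m i = t / (m + 1) := by
  simp only [gridPoint]
  push_cast
  ring

theorem gridPoint_le (t : ℝ≥0) {m i : ℕ} (hi : i ≤ m + 1) : gridPoint t m i ≤ t :=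
  (monotone_gridPoint t m hi).trans_eq (gridPoint_last t m)

theorem tendsto_mesh (t : ℝ≥0) : Tendsto (fun m : ℕ => (t : ℝ) / (m + 1)) atTop (𝓝 0) := by
  simpa [div_eq_mul_inv] using (tendsto_one_div_add_atTop_nhds_zero_nat (𝕜 := ℝ)).const_mul (t : ℝ)

/-- The quadratic variation of a path with unit jumps is its number of jumps. -/
theorem eventually_sum_sq_gridPoint_eq {c : ℝ≥0 → ℕ} (hc : Monotone c) (hc0 : c 0 = 0) {t : ℝ≥0}
    (hgap : ∃ η > 0, ∀ s s' : ℝ≥0, s' ≤ t → (s' : ℝ) - s < η → c s' ≤ c s + 1) :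
    ∀ᶠ m : ℕ in atTop, ∑ i ∈ Finset.range (m + 1),
      ((c (gridPoint t m (i + 1)) : ℝ) - c (gridPoint t m i)) ^ 2 = c t := by
  obtain ⟨η, hη, hgap⟩ := hgap
  filter_upwards [(tendsto_mesh t).eventually (gt_mem_nhds hη)] with m hm
  calc ∑ i ∈ Finset.range (m + 1),
      ((c (gridPoint t m (i + 1)) : ℝ) - c (gridPoint t m i)) ^ 2
      = ∑ i ∈ Finset.range (m + 1), ((c (gridPoint t m (i + 1)) : ℝ) - c (gridPoint t m i)) := by
        refine Finset.sum_congr rfl fun i hi => ?_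
        have h1 := hc (monotone_gridPoint t m (Nat.le_add_right i 1))
        have h2 := hgap (gridPoint t m i) (gridPoint t m (i + 1))
          (gridPoint_le t (Finset.mem_range.1 hi)) (by rwa [gridPoint_succ_sub])
        have h3 : c (gridPoint t m (i + 1)) = c (gridPoint t m i) ∨
            c (gridPoint t m (i + 1)) = c (gridPoint t m i) + 1 := by omega
        rcases h3 with h3 | h3 <;> simp [h3]
    _ = c t := by
        rw [Finset.sum_range_sub fun i => (c (gridPoint t m i) : ℝ), gridPoint_last, gridPoint_zero,
          hc0]
        simp

/-- A continuous monotone path has no quadratic variation. -/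
theorem tendsto_sum_sq_gridPoint_zero {L : ℝ≥0 → ℝ} (hL : Monotone L) (hLc : Continuous L)
    (t : ℝ≥0) :
    Tendsto (fun m : ℕ => ∑ i ∈ Finset.range (m + 1),
      (L (gridPoint t m (i + 1)) - L (gridPoint t m i)) ^ 2) atTop (𝓝 0) := by
  refine Metric.tendsto_nhds.2 fun ε hε => ?_
  have hD : 0 ≤ L t - L 0 := sub_nonneg.2 (hL zero_le)
  set ε' := ε / (L t - L 0 + 1) with hε'
  have hε'0 : 0 < ε' := by positivity
  have huc : UniformContinuousOn L (Set.Icc 0 t) :=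
    isCompact_Icc.uniformContinuousOn_of_continuous hLc.continuousOn
  obtain ⟨δ, hδ, H⟩ := Metric.uniformContinuousOn_iff.1 huc ε' hε'0
  filter_upwards [(tendsto_mesh t).eventually (gt_mem_nhds hδ)] with m hm
  have hmono : ∀ i < m + 1, L (gridPoint t m i) ≤ L (gridPoint t m (i + 1)) := fun i _ =>
    hL (monotone_gridPoint t m (Nat.le_add_right i 1))
  have h := sum_range_sub_sq_le (f := fun i => L (gridPoint t m i)) (ε := ε') (m := m + 1) hmono
    fun i hi => by
      have h1 := H (gridPoint t m (i + 1)) ⟨zero_le, gridPoint_le t hi⟩ (gridPoint t m i)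
        ⟨zero_le, gridPoint_le t hi.le⟩ (by
          rw [NNReal.dist_eq, gridPoint_succ_sub, abs_of_nonneg (by positivity)]
          exact hm)
      rw [Real.dist_eq] at h1
      exact (le_abs_self _).trans h1.le
  simp only [gridPoint_last, gridPoint_zero] at h
  rw [Real.dist_eq, sub_zero, abs_of_nonneg (Finset.sum_nonneg fun i _ => sq_nonneg _)]
  refine h.trans_lt ?_
  rw [hε', div_mul_eq_mul_div, div_lt_iff₀ (by positivity)]
  nlinarith

section Martingale

variable {Ω : Type*} [mΩ : MeasurableSpace Ω] {P : Measure Ω} [IsProbabilityMeasure P]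

/-- Orthogonality of the increments of a bounded martingale. -/
theorem integral_sub_sq_of_martingale {F : Filtration ℝ≥0 mΩ} {Z : ℝ≥0 → Ω → ℝ}
    (hZ : Martingale Z F P) {s t : ℝ≥0} (hst : s ≤ t) {C : ℝ} (hs : ∀ ω, |Z s ω| ≤ C)
    (ht : ∀ ω, |Z t ω| ≤ C) :
    ∫ ω, (Z t ω - Z s ω) ^ 2 ∂P = ∫ ω, Z t ω ^ 2 ∂P - ∫ ω, Z s ω ^ 2 ∂P := by
  have hb : ∀ {u v}, (∀ ω, |Z u ω| ≤ C) → (∀ ω, |Z v ω| ≤ C) →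
      Integrable (fun ω => Z u ω * Z v ω) P := fun {u v} hu hv => by
    refine (hZ.integrable v).bdd_mul (c := C) (hZ.integrable u).aestronglyMeasurable ?_
    exact Eventually.of_forall hu
  have hcross : ∫ ω, Z s ω * Z t ω ∂P = ∫ ω, Z s ω * Z s ω ∂P := by
    have h1 := condExp_mul_of_stronglyMeasurable_left (μ := P) (hZ.1 s) (hb hs ht) (hZ.integrable t)
    rw [← integral_condExp (F.le s)]
    refine integral_congr_ae ?_
    refine h1.trans ?_
    filter_upwards [hZ.2 s t hst] with ω hω
    simp [hω]
  have : ∀ ω, (Z t ω - Z s ω) ^ 2 = Z t ω * Z t ω - 2 * (Z s ω * Z t ω) + Z s ω * Z s ω :=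
    fun ω => by ring
  simp_rw [this, sq]
  have hsub : Integrable (fun ω => Z t ω * Z t ω - 2 * (Z s ω * Z t ω)) P :=
    (hb ht ht).sub ((hb hs ht).const_mul 2)
  rw [integral_add hsub (hb hs hs),
    integral_sub (hb ht ht) ((hb hs ht).const_mul 2), integral_const_mul, hcross]
  ring

/-- The second moment of a bounded martingale `Z = c - L`, with `c` a counting process and `L`
continuous and nondecreasing, is controlled by the expected number of jumps. It is the expectation
of the sums of squared increments over finer and finer subdivisions. -/
theorem integral_sq_le_of_martingale_sub {F : Filtration ℝ≥0 mΩ} {Z : ℝ≥0 → Ω → ℝ}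
    {c : ℝ≥0 → Ω → ℕ} {L : ℝ≥0 → Ω → ℝ} (hZ : Martingale Z F P)
    (hZcL : ∀ t ω, Z t ω = c t ω - L t ω) (hcm : ∀ t, Measurable (c t))
    (hc : ∀ ω, Monotone fun t => c t ω) (hc0 : ∀ ω, c 0 ω = 0)
    (hL : ∀ ω, Monotone fun t => L t ω) (hL0 : ∀ ω, L 0 ω = 0)
    (hLc : ∀ ω, Continuous fun t => L t ω) {t : ℝ≥0}
    (hgap : ∀ ω, ∃ η > 0, ∀ s s' : ℝ≥0, s' ≤ t → (s' : ℝ) - s < η → c s' ω ≤ c s ω + 1)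
    {C : ℝ} (hcC : ∀ ω, (c t ω : ℝ) ≤ C) (hLC : ∀ ω, L t ω ≤ C) :
    Integrable (fun ω => Z t ω ^ 2) P ∧ ∫ ω, Z t ω ^ 2 ∂P ≤ 2 * ∫ ω, (c t ω : ℝ) ∂P := by
  have hL_nonneg : ∀ s ω, 0 ≤ L s ω := fun s ω => (hL0 ω).symm.le.trans (hL ω zero_le)
  have hcmono : ∀ ω {s s' : ℝ≥0}, s ≤ s' → (c s ω : ℝ) ≤ c s' ω := fun ω s s' h => by
    exact_mod_cast hc ω h
  have hZC : ∀ s ≤ t, ∀ ω, |Z s ω| ≤ C := fun s hs ω => by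
    have h1 := hcmono ω hs
    have h2 : L s ω ≤ L t ω := hL ω hs
    have h3 := hL_nonneg s ω
    have h4 := hcC ω
    have h5 := hLC ω
    have h6 : (0 : ℝ) ≤ c s ω := Nat.cast_nonneg _
    rw [hZcL, abs_le]
    constructor <;> linarith
  have hZm : ∀ s, Measurable (Z s) := fun s => ((hZ.1 s).mono (F.le s)).measurable
  have hcm' : ∀ s, Measurable fun ω => (c s ω : ℝ) := fun s =>
    measurable_from_nat.comp (hcm s)
  have hLm : ∀ s, Measurable (L s) := fun s => by
    have : L s = fun ω => (c s ω : ℝ) - Z s ω := by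
      ext ω
      rw [hZcL]
      ring
    rw [this]
    exact (hcm' s).sub (hZm s)
  refine ⟨Integrable.of_bound ((hZm t).pow_const 2).aestronglyMeasurable (C ^ 2)
    (Eventually.of_forall fun ω => ?_), ?_⟩
  · have h := abs_le.1 (hZC t le_rfl ω)
    rw [Real.norm_of_nonneg (sq_nonneg _)]
    exact sq_le_sq' h.1 h.2
  set G : ℕ → Ω → ℝ := fun m ω => 2 * (∑ i ∈ Finset.range (m + 1),
      ((c (gridPoint t m (i + 1)) ω : ℝ) - c (gridPoint t m i) ω) ^ 2 +
    ∑ i ∈ Finset.range (m + 1),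
      (L (gridPoint t m (i + 1)) ω - L (gridPoint t m i) ω) ^ 2) with hG
  have hGm : ∀ m, Measurable (G m) := fun m => by
    refine Measurable.const_mul (Measurable.add ?_ ?_) 2
    · exact Finset.measurable_fun_sum _ fun i _ => ((hcm' _).sub (hcm' _)).pow_const 2
    · exact Finset.measurable_fun_sum _ fun i _ => ((hLm _).sub (hLm _)).pow_const 2
  have hG_nonneg : ∀ m ω, 0 ≤ G m ω := fun m ω => by positivity
  have hG_le : ∀ m ω, G m ω ≤ 2 * (C * C + C * C) := fun m ω => by
    have hC : 0 ≤ C := (Nat.cast_nonneg _).trans (hcC ω)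
    have h1 := sum_range_sub_sq_le (f := fun i => (c (gridPoint t m i) ω : ℝ)) (ε := C)
      (m := m + 1) (fun i _ => hcmono ω (monotone_gridPoint t m (Nat.le_add_right i 1))) fun i hi => by
        have := hcmono ω (gridPoint_le t (Nat.succ_le_of_lt hi))
        have h2 := hcC ω
        have h3 : (0 : ℝ) ≤ c (gridPoint t m i) ω := Nat.cast_nonneg _
        linarith
    have h2 := sum_range_sub_sq_le (f := fun i => L (gridPoint t m i) ω) (ε := C)
      (m := m + 1) (fun i _ => hL ω (monotone_gridPoint t m (Nat.le_add_right i 1))) fun i hi => by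
        have : L (gridPoint t m (i + 1)) ω ≤ L t ω := hL ω (gridPoint_le t (Nat.succ_le_of_lt hi))
        have h2 := hLC ω
        have h3 := hL_nonneg (gridPoint t m i) ω
        linarith
    simp only [gridPoint_last, gridPoint_zero, hc0, hL0, Nat.cast_zero, sub_zero] at h1 h2
    have h3 := mul_le_mul_of_nonneg_left (hcC ω) hC
    have h4 := mul_le_mul_of_nonneg_left (hLC ω) hC
    simp only [hG]
    linarith
  have hG_int : ∀ m, Integrable (G m) P := fun m =>
    Integrable.of_bound (hGm m).aestronglyMeasurable (2 * (C * C + C * C))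
      (Eventually.of_forall fun ω => by
        rw [Real.norm_of_nonneg (hG_nonneg m ω)]
        exact hG_le m ω)
  have hlim : Tendsto (fun m => ∫ ω, G m ω ∂P) atTop (𝓝 (∫ ω, 2 * (c t ω : ℝ) ∂P)) := by
    refine tendsto_integral_of_dominated_convergence (fun _ => 2 * (C * C + C * C))
      (fun m => (hGm m).aestronglyMeasurable) (integrable_const _)
      (fun m => Eventually.of_forall fun ω => ?_) (Eventually.of_forall fun ω => ?_)
    · rw [Real.norm_of_nonneg (hG_nonneg m ω)]
      exact hG_le m ω
    · have h1 : Tendsto (fun m : ℕ => ∑ i ∈ Finset.range (m + 1),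
          ((c (gridPoint t m (i + 1)) ω : ℝ) - c (gridPoint t m i) ω) ^ 2) atTop (𝓝 (c t ω)) :=
        tendsto_const_nhds.congr' ((eventually_sum_sq_gridPoint_eq (hc ω) (hc0 ω) (hgap ω)).mono
          fun m hm => hm.symm)
      have h2 := tendsto_sum_sq_gridPoint_zero (hL ω) (hLc ω) t
      simpa using (h1.add h2).const_mul 2
  rw [integral_const_mul] at hlim
  refine ge_of_tendsto' hlim fun m => ?_
  have hsq : ∀ i < m + 1, Integrable
      (fun ω => (Z (gridPoint t m (i + 1)) ω - Z (gridPoint t m i) ω) ^ 2) P := fun i hi => by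
    refine Integrable.of_bound (((hZm _).sub (hZm _)).pow_const 2).aestronglyMeasurable
      ((2 * C) ^ 2) (Eventually.of_forall fun ω => ?_)
    have h1 := abs_le.1 (hZC _ (gridPoint_le t (Nat.succ_le_of_lt hi)) ω)
    have h2 := abs_le.1 (hZC _ (gridPoint_le t hi.le) ω)
    rw [Real.norm_of_nonneg (sq_nonneg _)]
    exact sq_le_sq' (by linarith) (by linarith)
  have hZ0 : ∀ ω, Z 0 ω = 0 := fun ω => by simp [hZcL, hc0, hL0]
  calc ∫ ω, Z t ω ^ 2 ∂P
      = ∑ i ∈ Finset.range (m + 1), (∫ ω, Z (gridPoint t m (i + 1)) ω ^ 2 ∂P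
          - ∫ ω, Z (gridPoint t m i) ω ^ 2 ∂P) := by
        rw [Finset.sum_range_sub fun i => ∫ ω, Z (gridPoint t m i) ω ^ 2 ∂P, gridPoint_last,
          gridPoint_zero]
        simp [hZ0]
    _ = ∑ i ∈ Finset.range (m + 1),
          ∫ ω, (Z (gridPoint t m (i + 1)) ω - Z (gridPoint t m i) ω) ^ 2 ∂P := by
        refine Finset.sum_congr rfl fun i hi => ?_
        have hi' := Finset.mem_range.1 hi
        rw [integral_sub_sq_of_martingale hZ (monotone_gridPoint t m (Nat.le_add_right i 1))
          (hZC _ (gridPoint_le t hi'.le)) (hZC _ (gridPoint_le t (Nat.succ_le_of_lt hi')))]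
    _ = ∫ ω, ∑ i ∈ Finset.range (m + 1),
          (Z (gridPoint t m (i + 1)) ω - Z (gridPoint t m i) ω) ^ 2 ∂P :=
        (integral_finsetSum _ fun i hi => hsq i (Finset.mem_range.1 hi)).symm
    _ ≤ ∫ ω, G m ω ∂P := by
        refine integral_mono (integrable_finsetSum _ fun i hi => hsq i (Finset.mem_range.1 hi))
          (hG_int m) fun ω => ?_
        simp only [hG]
        rw [← Finset.sum_add_distrib, Finset.mul_sum]
        refine Finset.sum_le_sum fun i _ => ?_
        simp only [hZcL]
        nlinarith [sq_nonneg (((c (gridPoint t m (i + 1)) ω : ℝ) - c (gridPoint t m i) ω) +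
          (L (gridPoint t m (i + 1)) ω - L (gridPoint t m i) ω))]

end Martingale

/-! ### Laws of large numbers along the squares -/

section SquareSubsequence

variable {Ω : Type*} [MeasurableSpace Ω] {P : Measure Ω}

/-- If second moments grow at most linearly, the strong law holds along the squares, since
`∑ 1 / n ^ 2` converges. -/
theorem ae_tendsto_div_sq {Y : ℕ → Ω → ℝ} (hY : ∀ n, Measurable (Y n)) {C : ℝ}
    (h : ∀ n, ∫⁻ ω, ENNReal.ofReal (Y n ω ^ 2) ∂P ≤ ENNReal.ofReal (C * n)) :
    ∀ᵐ ω ∂P, Tendsto (fun n : ℕ => Y (n ^ 2) ω / (n ^ 2 : ℕ)) atTop (𝓝 0) := by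
  have hgm : ∀ n : ℕ, Measurable
      fun ω => ENNReal.ofReal ((Y (n ^ 2) ω / (n ^ 2 : ℕ)) ^ 2) := fun n =>
    (((hY _).div_const _).pow_const 2).ennreal_ofReal
  have hg : ∀ n : ℕ, ∫⁻ ω, ENNReal.ofReal ((Y (n ^ 2) ω / (n ^ 2 : ℕ)) ^ 2) ∂P
      ≤ ENNReal.ofReal (C * (1 / (n : ℝ) ^ 2)) := fun n => by
    have h1 : ∀ ω, ENNReal.ofReal ((Y (n ^ 2) ω / (n ^ 2 : ℕ)) ^ 2)
        = ENNReal.ofReal ((1 / ((n ^ 2 : ℕ) : ℝ)) ^ 2) * ENNReal.ofReal (Y (n ^ 2) ω ^ 2) :=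
      fun ω => by
        rw [← ENNReal.ofReal_mul (sq_nonneg _)]
        congr 1
        ring
    simp_rw [h1]
    rw [lintegral_const_mul _ ((hY _).pow_const 2).ennreal_ofReal]
    refine (mul_le_mul_right (h _) _).trans ?_
    rw [← ENNReal.ofReal_mul (sq_nonneg _)]
    refine ENNReal.ofReal_le_ofReal (le_of_eq ?_)
    push_cast
    rcases eq_or_ne n 0 with rfl | hn
    · simp
    · have : (n : ℝ) ≠ 0 := by exact_mod_cast hn
      field_simp
  have hsum : Summable fun n : ℕ => C * (1 / (n : ℝ) ^ 2) :=
    (Real.summable_one_div_nat_pow.2 one_lt_two).mul_left C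
  have hfin : ∫⁻ ω, ∑' n : ℕ, ENNReal.ofReal ((Y (n ^ 2) ω / (n ^ 2 : ℕ)) ^ 2) ∂P ≠ ⊤ := by
    rw [lintegral_tsum fun n => (hgm n).aemeasurable]
    exact ne_top_of_le_ne_top hsum.tsum_ofReal_ne_top (ENNReal.tsum_le_tsum hg)
  filter_upwards [ae_lt_top (Measurable.tsum hgm) hfin] with ω hω
  have h1 := ENNReal.tendsto_atTop_zero_of_tsum_ne_top hω.ne
  have h2 := (ENNReal.tendsto_toReal ENNReal.zero_ne_top).comp h1
  simp only [Function.comp_def, ENNReal.toReal_ofReal (sq_nonneg _), ENNReal.toReal_zero] at h2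
  have h3 := (Real.continuous_sqrt.tendsto 0).comp h2
  simp only [Function.comp_def, Real.sqrt_sq_eq_abs, Real.sqrt_zero] at h3
  exact (tendsto_zero_iff_abs_tendsto_zero _).2 h3

end SquareSubsequence

theorem tendsto_div_of_tendsto_div_sq {u : ℕ → ℝ} (hu : Monotone u) {l : ℝ}
    (h : Tendsto (fun n : ℕ => u (n ^ 2) / (n ^ 2 : ℕ)) atTop (𝓝 l)) :
    Tendsto (fun n : ℕ => u n / n) atTop (𝓝 l) := by
  refine tendsto_div_of_monotone_of_exists_subseq_tendsto_div u l hu fun a ha =>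
    ⟨fun n => n ^ 2, ?_, tendsto_pow_atTop two_ne_zero, h⟩
  have h1 : Tendsto (fun n : ℕ => (1 + (1 : ℝ) / n) ^ 2) atTop (𝓝 1) := by
    simpa using ((tendsto_one_div_atTop_nhds_zero_nat (𝕜 := ℝ)).const_add 1).pow 2
  filter_upwards [h1.eventually (gt_mem_nhds ha), eventually_gt_atTop 0] with n hn hn0
  have hn0' : (0 : ℝ) < n := by exact_mod_cast hn0
  push_cast
  have : ((n : ℝ) + 1) ^ 2 = (1 + 1 / n) ^ 2 * n ^ 2 := by field_simp
  rw [this]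
  gcongr

/-! ### The law of large numbers for the Hawkes process -/

/-- Two-sided renewal bounds determine the limit `b / (1 - θ)`: the lower bound forces
`liminf x ≥ b + θ * liminf x`. -/
theorem tendsto_of_renewal_bounds {x m r : ℕ → ℝ} {b θ : ℝ} (hθ0 : 0 < θ) (hθ1 : θ < 1)
    (hx : ∀ n, 0 ≤ x n) (hm : Tendsto m atTop (𝓝 0)) (hr : Tendsto r atTop (𝓝 1))
    (hup : ∀ᶠ n in atTop, (1 - θ) * x n ≤ b + m n)
    (hlow : ∀ φ, 0 ≤ φ → φ < θ →
      ∀ᶠ n in atTop, b + φ * (r n * x n) + m (n + 1) ≤ x (n + 1)) :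
    Tendsto x atTop (𝓝 (b / (1 - θ))) := by
  have h1θ : 0 < 1 - θ := by linarith
  have hup' : ∀ ε > 0, ∀ᶠ n in atTop, x n < b / (1 - θ) + ε := fun ε hε => by
    filter_upwards [hup, hm.eventually (gt_mem_nhds (mul_pos h1θ hε))] with n h1 h2
    rw [div_add' _ _ _ h1θ.ne', lt_div_iff₀ h1θ]
    linarith
  have hbdd : IsBoundedUnder (· ≥ ·) atTop x := ⟨0, eventually_map.2 (Eventually.of_forall hx)⟩
  have hcobdd : IsCoboundedUnder (· ≥ ·) atTop x :=
    IsBoundedUnder.isCoboundedUnder_ge ⟨b / (1 - θ) + 1, (hup' 1 one_pos).mono fun _ h => h.le⟩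
  set l := liminf x atTop with hl
  have hgt : ∀ a < l, ∀ᶠ n in atTop, a < x n := fun a ha => eventually_lt_of_lt_liminf ha hbdd
  have hδ : ∀ δ ∈ Set.Ioo (0 : ℝ) 1, b + θ * (1 - δ) * (l - 2 * δ) - δ ≤ l := fun δ hδ => by
    refine le_liminf_of_le hcobdd ?_
    suffices h : ∀ᶠ n in atTop, b + θ * (1 - δ) * (l - 2 * δ) - δ ≤ x (n + 1) by
      rw [← map_add_atTop_eq_nat 1]
      exact eventually_map.2 h
    have hφ0 : 0 ≤ θ * (1 - δ) := mul_nonneg hθ0.le (by linarith [hδ.2])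
    have hφ1 : θ * (1 - δ) < θ := by nlinarith [hδ.1]
    have hr' : Tendsto (fun n => r n * (l - δ)) atTop (𝓝 (l - δ)) := by
      simpa using hr.mul_const (l - δ)
    have hm' : ∀ᶠ n in atTop, -δ < m (n + 1) :=
      ((tendsto_add_atTop_iff_nat 1).2 hm).eventually (lt_mem_nhds (by linarith [hδ.1]))
    filter_upwards [hlow _ hφ0 hφ1, hgt (l - δ) (by linarith [hδ.1]), hm',
      hr'.eventually (lt_mem_nhds (show l - 2 * δ < l - δ by linarith [hδ.1])),
      hr.eventually (lt_mem_nhds zero_lt_one)] with n h1 h2 h3 h4 h5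
    have h6 : r n * (l - δ) ≤ r n * x n := mul_le_mul_of_nonneg_left h2.le h5.le
    have h7 := mul_le_mul_of_nonneg_left (h4.le.trans h6) hφ0
    linarith
  have hfix : b + θ * l ≤ l := by
    have hc : Continuous fun δ : ℝ => b + θ * (1 - δ) * (l - 2 * δ) - δ := by fun_prop
    have ht : Tendsto (fun δ : ℝ => b + θ * (1 - δ) * (l - 2 * δ) - δ) (𝓝[>] 0)
        (𝓝 (b + θ * l)) := by
      have := (hc.tendsto 0).mono_left (nhdsWithin_le_nhds (s := Set.Ioi 0))
      simpa using this
    refine le_of_tendsto ht ?_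
    filter_upwards [Ioo_mem_nhdsGT one_pos] with δ h using hδ δ h
  have hρl : b / (1 - θ) ≤ l := by
    rw [div_le_iff₀ h1θ]
    linarith
  refine tendsto_order.2 ⟨fun a ha => hgt a (ha.trans_le hρl), fun a ha => ?_⟩
  filter_upwards [hup' (a - b / (1 - θ)) (sub_pos.2 ha)] with n hn
  linarith

section HawkesLLN

variable {Ω : Type*} [MeasurableSpace Ω] {P : Measure Ω} {N : ℝ≥0 → Ω → ℕ} {lam : ℝ} {μ : ℝ → ℝ}

theorem tendsto_stopped_compensated (hN : IsCountingProcess N) (lam : ℝ) (μ : ℝ → ℝ) (t : ℝ≥0)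
    (ω : Ω) :
    Tendsto (fun k : ℕ => stoppedProcess
      (fun t ω => (N t ω : ℝ) - hawkesCompensator lam μ N t ω) (arrivalTime N k) t ω) atTop
      (𝓝 (N t ω - hawkesCompensator lam μ N t ω)) := by
  refine tendsto_const_nhds.congr' ?_
  filter_upwards [eventually_gt_atTop (N t ω)] with k hk
  change _ = (N (stopAt N k t ω) ω : ℝ) - hawkesCompensator lam μ N (stopAt N k t ω) ω
  rw [stopAt_eq_self hN hk]

theorem measurable_stopped_compensated (hN : IsHawkesProcess lam μ N P) (k : ℕ) (t : ℝ≥0) :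
    Measurable (stoppedProcess (fun t ω => (N t ω : ℝ) - hawkesCompensator lam μ N t ω)
      (arrivalTime N k) t) :=
  (((hN.martingale k).1 t).mono (hN.counting.history.le t)).measurable

theorem measurable_compensated (hN : IsHawkesProcess lam μ N P) (t : ℝ≥0) :
    Measurable fun ω => (N t ω : ℝ) - hawkesCompensator lam μ N t ω :=
  measurable_of_tendsto_metrizable (fun k => measurable_stopped_compensated hN k t)
    (tendsto_pi_nhds.2 fun ω => tendsto_stopped_compensated hN.counting lam μ t ω)

variable [IsProbabilityMeasure P]

/-- Up to the `k`-th arrival both the count and the compensator are bounded, so that the stopped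
compensated process is square integrable. Its mean being `0`, the mean count `n` satisfies
`n ≤ lam * t + (∫ μ) * n`. -/
theorem lintegral_sq_stopped_compensated_le (hN : IsHawkesProcess lam μ N P) (hlam : 0 ≤ lam)
    (hμ_nonneg : ∀ t, 0 ≤ t → 0 ≤ μ t) (hμ_int : IntegrableOn μ (Set.Ioi 0))
    (hμ_lt : (∫ s in Set.Ioi 0, μ s) < 1) (k : ℕ) (t : ℝ≥0) :
    ∫⁻ ω, ENNReal.ofReal (stoppedProcess
        (fun t ω => (N t ω : ℝ) - hawkesCompensator lam μ N t ω) (arrivalTime N k) t ω ^ 2) ∂P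
      ≤ ENNReal.ofReal (2 * (lam / (1 - ∫ s in Set.Ioi 0, μ s)) * t) := by
  have hc := hN.counting
  set θ := ∫ s in Set.Ioi 0, μ s with hθ
  have hθ0 : 0 ≤ θ := setIntegral_nonneg measurableSet_Ioi fun x hx => hμ_nonneg x (le_of_lt hx)
  set Z := stoppedProcess (fun t ω => (N t ω : ℝ) - hawkesCompensator lam μ N t ω)
    (arrivalTime N k) with hZ
  set c : ℝ≥0 → Ω → ℕ := fun t ω => min (N t ω) k with hcdef
  set L : ℝ≥0 → Ω → ℝ := fun t ω => hawkesCompensator lam μ N (stopAt N k t ω) ω with hL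
  have hZcL : ∀ t ω, Z t ω = c t ω - L t ω := fun t ω => by
    change (N (stopAt N k t ω) ω : ℝ) - _ = _
    rw [apply_stopAt hc]
    rfl
  have hcm : ∀ t, Measurable (c t) := fun t => (hc.measurable t).min measurable_const
  have hLle : ∀ ω, L t ω ≤ lam * t + θ * c t ω := fun ω => by
    refine (hawkesCompensator_le hc hμ_nonneg hμ_int _ ω).trans ?_
    rw [apply_stopAt hc]
    have : (stopAt N k t ω : ℝ) ≤ t := by exact_mod_cast stopAt_le N k t ω
    gcongr
  have hck : ∀ ω, (c t ω : ℝ) ≤ k := fun ω => by exact_mod_cast min_le_right _ _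
  have hcmono : ∀ ω, Monotone fun t => c t ω := fun ω => (hc.mono ω).min monotone_const
  have hc0 : ∀ ω, c 0 ω = 0 := fun ω => by simp [hcdef, hc.zero]
  have hL0 : ∀ ω, L 0 ω = 0 := fun ω => by
    simp only [hL, le_zero_iff.1 (stopAt_le N k 0 ω), hawkesCompensator_zero]
  have hlt : 0 ≤ lam * t := mul_nonneg hlam t.2
  obtain ⟨hsq_int, hsq⟩ := integral_sq_le_of_martingale_sub (hN.martingale k) hZcL hcm hcmono hc0
    (fun ω => (monotone_hawkesCompensator hc hlam hμ_nonneg hμ_int ω).comp (stopAt_mono N k ω))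
    hL0
    (fun ω => (continuous_hawkesCompensator hc hμ_int ω).comp (continuous_stopAt N k ω))
    (t := t) (C := lam * t + k)
    (fun ω => by
      obtain ⟨η, hη, H⟩ := exists_gap (hc.mono ω) (hc.rightContinuous ω) (hc.unitJumps ω) t
      refine ⟨η, hη, fun s s' hs' hlt => ?_⟩
      have := H s s' hs' hlt
      simp only [hcdef]
      omega)
    (fun ω => (hck ω).trans (by linarith))
    (fun ω => (hLle ω).trans (by nlinarith [hck ω, Nat.cast_nonneg (α := ℝ) (c t ω)]))
  have hc_int : Integrable (fun ω => (c t ω : ℝ)) P :=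
    Integrable.of_bound (measurable_from_nat.comp (hcm t)).aestronglyMeasurable k
      (Eventually.of_forall fun ω => by
        rw [Real.norm_of_nonneg (Nat.cast_nonneg _)]
        exact hck ω)
  have hZ_int : Integrable (Z t) P := (hN.martingale k).integrable t
  have hmean : ∫ ω, Z t ω ∂P = 0 := by
    rw [← integral_condExp (hc.history.le 0), integral_congr_ae ((hN.martingale k).2 0 t zero_le)]
    refine integral_eq_zero_of_ae (Eventually.of_forall fun ω => ?_)
    change Z 0 ω = 0
    rw [hZcL, hc0, hL0]
    simp
  have hcle : ∫ ω, (c t ω : ℝ) ∂P ≤ lam * t + θ * ∫ ω, (c t ω : ℝ) ∂P := by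
    calc ∫ ω, (c t ω : ℝ) ∂P = ∫ ω, ((c t ω : ℝ) - Z t ω) ∂P := by
          rw [integral_sub hc_int hZ_int, hmean, sub_zero]
      _ ≤ ∫ ω, (lam * t + θ * (c t ω : ℝ)) ∂P := by
          refine integral_mono (hc_int.sub hZ_int) ((integrable_const _).add (hc_int.const_mul θ))
            fun ω => ?_
          have := hZcL t ω
          have := hLle ω
          linarith
      _ = _ := by
          rw [integral_add (integrable_const _) (hc_int.const_mul θ), integral_const_mul θ]
          simp
  rw [← ofReal_integral_eq_lintegral_ofReal hsq_int (Eventually.of_forall fun ω => sq_nonneg _)]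
  refine ENNReal.ofReal_le_ofReal (hsq.trans ?_)
  rw [mul_assoc]
  gcongr
  rw [div_mul_eq_mul_div, le_div_iff₀ (by linarith)]
  linarith

theorem lintegral_sq_compensated_le (hN : IsHawkesProcess lam μ N P) (hlam : 0 ≤ lam)
    (hμ_nonneg : ∀ t, 0 ≤ t → 0 ≤ μ t) (hμ_int : IntegrableOn μ (Set.Ioi 0))
    (hμ_lt : (∫ s in Set.Ioi 0, μ s) < 1) (t : ℝ≥0) :
    ∫⁻ ω, ENNReal.ofReal (((N t ω : ℝ) - hawkesCompensator lam μ N t ω) ^ 2) ∂P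
      ≤ ENNReal.ofReal (2 * (lam / (1 - ∫ s in Set.Ioi 0, μ s)) * t) := by
  have hlim : ∀ ω, liminf (fun k : ℕ => ENNReal.ofReal (stoppedProcess
      (fun t ω => (N t ω : ℝ) - hawkesCompensator lam μ N t ω) (arrivalTime N k) t ω ^ 2)) atTop
      = ENNReal.ofReal (((N t ω : ℝ) - hawkesCompensator lam μ N t ω) ^ 2) := fun ω =>
    ((ENNReal.continuous_ofReal.tendsto _).comp
      ((tendsto_stopped_compensated hN.counting lam μ t ω).pow 2)).liminf_eq
  simp_rw [← hlim]
  refine (lintegral_liminf_le fun k =>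
    ((measurable_stopped_compensated hN k t).pow_const 2).ennreal_ofReal).trans ?_
  refine liminf_le_of_le (by isBoundedDefault) fun b hb => ?_
  obtain ⟨k, hk⟩ := hb.exists
  exact hk.trans (lintegral_sq_stopped_compensated_le hN hlam hμ_nonneg hμ_int hμ_lt k t)

/-- **Law of large numbers for the Hawkes process.** -/
theorem ae_tendsto_hawkes_div (hN : IsHawkesProcess lam μ N P) (hlam : 0 ≤ lam)
    (hμ_nonneg : ∀ t, 0 ≤ t → 0 ≤ μ t) (hμ_int : IntegrableOn μ (Set.Ioi 0))
    (hμ_pos : 0 < ∫ s in Set.Ioi 0, μ s) (hμ_lt : (∫ s in Set.Ioi 0, μ s) < 1) :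
    ∀ᵐ ω ∂P, Tendsto (fun n : ℕ => (N n ω : ℝ) / n) atTop
      (𝓝 (lam / (1 - ∫ s in Set.Ioi 0, μ s))) := by
  have hc := hN.counting
  set θ := ∫ s in Set.Ioi 0, μ s with hθ
  have hM := ae_tendsto_div_sq (P := P) (C := 2 * (lam / (1 - θ)))
    (Y := fun n ω => (N n ω : ℝ) - hawkesCompensator lam μ N n ω)
    (fun n => measurable_compensated hN n) fun n => by
      simpa using lintegral_sq_compensated_le hN hlam hμ_nonneg hμ_int hμ_lt n
  filter_upwards [hM] with ω hω
  have hmono : Monotone fun n : ℕ => (N n ω : ℝ) := fun n n' h => by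
    have : N n ω ≤ N n' ω := hc.mono ω (show ((n : ℕ) : ℝ≥0) ≤ n' by exact_mod_cast h)
    exact Nat.cast_le.2 this
  refine tendsto_div_of_tendsto_div_sq hmono ?_
  have hr : Tendsto (fun n : ℕ => ((n : ℝ) / (n + 1)) ^ 2) atTop (𝓝 1) := by
    simpa using (tendsto_natCast_div_add_atTop (1 : ℝ)).pow 2
  refine tendsto_of_renewal_bounds hμ_pos hμ_lt (fun n => by positivity) hω hr ?_ ?_
  · filter_upwards [eventually_gt_atTop 0] with n hn
    have hn2 : (0 : ℝ) < (n ^ 2 : ℕ) := by positivity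
    have h1 := hawkesCompensator_le (lam := lam) hc hμ_nonneg hμ_int ((n ^ 2 : ℕ) : ℝ≥0) ω
    rw [← mul_div_assoc, div_le_iff₀ hn2, add_mul, div_mul_cancel₀ _ hn2.ne']
    rw [NNReal.coe_natCast] at h1
    linarith
  · intro φ hφ0 hφ
    obtain ⟨h, hh⟩ := ((tendsto_cumulativeExcitation hμ_int).eventually
      (lt_mem_nhds hφ)).and (eventually_ge_atTop 0) |>.exists
    obtain ⟨n₀, hn₀⟩ := exists_nat_ge h
    filter_upwards [eventually_ge_atTop n₀, eventually_gt_atTop 0] with n hn hn0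
    have hn2 : (0 : ℝ) < ((n + 1) ^ 2 : ℕ) := by positivity
    have hn1 : (0 : ℝ) < n := by exact_mod_cast hn0
    have hhn : h ≤ n := hn₀.trans (by exact_mod_cast hn)
    have h1 := le_hawkesCompensator (lam := lam) hc hμ_nonneg hμ_int
      (s := ((n ^ 2 : ℕ) : ℝ≥0)) (h := ⟨h, hh.2⟩) (t := (((n + 1) ^ 2 : ℕ) : ℝ≥0)) (by
        rw [← NNReal.coe_le_coe]
        push_cast
        change (n : ℝ) ^ 2 + h ≤ _
        nlinarith) ω
    rw [NNReal.coe_natCast] at h1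
    change lam * (((n + 1) ^ 2 : ℕ) : ℝ) + cumulativeExcitation μ h * _ ≤ _ at h1
    have h2 : φ * (N ((n ^ 2 : ℕ) : ℝ≥0) ω : ℝ)
        ≤ cumulativeExcitation μ h * N ((n ^ 2 : ℕ) : ℝ≥0) ω := by
      gcongr
      exact hh.1.le
    rw [le_div_iff₀ hn2, add_mul, div_mul_cancel₀ _ hn2.ne', add_mul]
    have h3 : φ * (((n : ℝ) / (n + 1)) ^ 2 * ((N ((n ^ 2 : ℕ) : ℝ≥0) ω : ℝ) / (n ^ 2 : ℕ)))
        * ((n + 1) ^ 2 : ℕ) = φ * N ((n ^ 2 : ℕ) : ℝ≥0) ω := by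
      push_cast
      field_simp
    rw [h3]
    linarith

end HawkesLLN

/-! ### The law of large numbers for the Markov chain -/

section MarkovChain

variable {Ω : Type*} [MeasurableSpace Ω] {P : Measure Ω} [IsProbabilityMeasure P]

section General

variable {E : Type*} [Fintype E] [DecidableEq E] [MeasurableSpace E] [MeasurableSingletonClass E]
  {p : Matrix E E ℝ} {X : ℕ → Ω → E}

/-- The Markov property, integrated against a function of the past. -/
theorem IsMarkovChain.integral_mul (hX : IsMarkovChain p X P) (f : E → ℝ) (k : ℕ)
    (G : (Fin (k + 1) → E) → ℝ) :
    ∫ ω, f (X (k + 1) ω) * G (fun i => X i ω) ∂P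
      = ∫ ω, (p *ᵥ f) (X k ω) * G (fun i => X i ω) ∂P := by
  set U : Ω → Fin (k + 1) → E := fun ω i => X i ω with hU
  have hUm : Measurable U := measurable_pi_lambda _ fun i => hX.measurable i
  have hVm : Measurable fun ω => (U ω, X (k + 1) ω) := hUm.prodMk (hX.measurable _)
  have h1 : ∫ ω, f (X (k + 1) ω) * G (U ω) ∂P
      = ∑ w, ∑ y, P.real {ω | U ω = w ∧ X (k + 1) ω = y} * (f y * G w) := by
    have := integral_map (μ := P) hVm.aemeasurable
      (f := fun v : (Fin (k + 1) → E) × E => f v.2 * G v.1)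
      (measurable_of_countable _).aestronglyMeasurable
    rw [← this, integral_fintype Integrable.of_finite, Fintype.sum_prod_type]
    refine Finset.sum_congr rfl fun w _ => Finset.sum_congr rfl fun y _ => ?_
    rw [map_measureReal_apply hVm (measurableSet_singleton _), smul_eq_mul]
    congr 2
    ext ω
    simp [Prod.ext_iff]
  have h2 : ∫ ω, (p *ᵥ f) (X k ω) * G (U ω) ∂P
      = ∑ w, P.real {ω | U ω = w} * ((p *ᵥ f) (w (Fin.last k)) * G w) := by
    have := integral_map (μ := P) hUm.aemeasurable
      (f := fun w : Fin (k + 1) → E => (p *ᵥ f) (w (Fin.last k)) * G w)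
      (measurable_of_countable _).aestronglyMeasurable
    have h3 : ∀ ω, X k ω = U ω (Fin.last k) := fun ω => by simp [hU]
    simp_rw [h3]
    rw [← this, integral_fintype Integrable.of_finite]
    refine Finset.sum_congr rfl fun w _ => ?_
    rw [map_measureReal_apply hUm (measurableSet_singleton _), smul_eq_mul]
    rfl
  rw [h1, h2]
  refine Finset.sum_congr rfl fun w _ => ?_
  have hP : ∀ y, P.real {ω | U ω = w ∧ X (k + 1) ω = y}
      = P.real {ω | U ω = w} * p (w (Fin.last k)) y := fun y => by
    set x : ℕ → E := fun i => if h : i < k + 1 then w ⟨i, h⟩ else y with hx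
    have hxw : ∀ ω, (∀ i ≤ k, X i ω = x i) ↔ U ω = w := fun ω => by
      rw [funext_iff, Fin.forall_iff]
      refine forall_congr' fun i => ?_
      constructor
      · intro h hi
        have := h (Nat.lt_succ_iff.1 hi)
        simpa [hx, hi, Nat.lt_succ_iff.1 hi, hU] using this
      · intro h hi
        have := h (Nat.lt_succ_iff.2 hi)
        simpa [hx, hi, hU] using this
    have hx1 : x (k + 1) = y := by simp [hx]
    have hxk : x k = w (Fin.last k) := by simp [hx, Fin.last]
    have := hX.markov k x
    simp only [Nat.le_succ_iff, or_imp, forall_and, forall_eq, hxw, hx1, hxk] at this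
    exact this
  simp_rw [hP]
  rw [Matrix.mulVec, dotProduct, Finset.sum_mul, Finset.mul_sum]
  refine Finset.sum_congr rfl fun y _ => by ring

/-- For an eigenfunction `f` of the transition matrix with eigenvalue `q`, the sums of
`f (X (k + 1)) - q * f (X k)` form a martingale with bounded increments; by orthogonality their
second moments grow at most linearly. -/
theorem IsMarkovChain.integral_sq_sum_le (hX : IsMarkovChain p X P) {f : E → ℝ} {q C : ℝ}
    (hf : p *ᵥ f = q • f) (hC : ∀ x y, |f x - q * f y| ≤ C) (n : ℕ) :
    ∫ ω, (∑ k ∈ Finset.range n, (f (X (k + 1) ω) - q * f (X k ω))) ^ 2 ∂P ≤ C ^ 2 * n := by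
  have hfm : ∀ k, Measurable fun ω => f (X k ω) := fun k =>
    (measurable_of_countable f).comp (hX.measurable k)
  have hDm : ∀ k, Measurable fun ω => f (X (k + 1) ω) - q * f (X k ω) := fun k =>
    (hfm _).sub ((hfm _).const_mul q)
  have hMm : ∀ n, Measurable fun ω => ∑ k ∈ Finset.range n, (f (X (k + 1) ω) - q * f (X k ω)) :=
    fun n => Finset.measurable_fun_sum _ fun k _ => hDm k
  have hMle : ∀ n ω, |∑ k ∈ Finset.range n, (f (X (k + 1) ω) - q * f (X k ω))| ≤ n * C :=
    fun n ω => (Finset.abs_sum_le_sum_abs _ _).trans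
      ((Finset.sum_le_card_nsmul _ _ C fun k _ => hC _ _).trans (by simp))
  obtain ⟨B, hB⟩ : ∃ B, ∀ x, |f x| ≤ B :=
    ⟨∑ x, |f x|, fun x => Finset.single_le_sum (fun i _ => abs_nonneg (f i)) (Finset.mem_univ x)⟩
  induction n with
  | zero => simp
  | succ n ih =>
    set M : Ω → ℝ := fun ω => ∑ k ∈ Finset.range n, (f (X (k + 1) ω) - q * f (X k ω)) with hM
    have hMint : Integrable M P := Integrable.of_bound (hMm n).aestronglyMeasurable (n * C)
      (Eventually.of_forall (hMle n))
    have hmul : ∀ k, Integrable (fun ω => f (X k ω) * M ω) P := fun k =>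
      hMint.bdd_mul (c := B) (hfm k).aestronglyMeasurable (Eventually.of_forall fun ω => hB _)
    have hsq : ∀ {g : Ω → ℝ} {K : ℝ}, Measurable g → (∀ ω, |g ω| ≤ K) →
        Integrable (fun ω => g ω ^ 2) P := fun {g K} hg hK =>
      Integrable.of_bound (hg.pow_const 2).aestronglyMeasurable (K ^ 2)
        (Eventually.of_forall fun ω => by
          rw [Real.norm_of_nonneg (sq_nonneg _)]
          have := abs_le.1 (hK ω)
          exact sq_le_sq' this.1 this.2)
    have hcross : ∫ ω, f (X (n + 1) ω) * M ω ∂P = q * ∫ ω, f (X n ω) * M ω ∂P := by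
      have h := hX.integral_mul f n
        (fun u => ∑ k : Fin n, (f (u k.succ) - q * f (u k.castSucc)))
      have hG : ∀ ω, (∑ k : Fin n, (f (X (k.succ : Fin (n + 1)) ω)
          - q * f (X (k.castSucc : Fin (n + 1)) ω))) = M ω := fun ω => by
        simp only [hM, Finset.sum_range, Fin.val_succ, Fin.val_castSucc]
      simp only [hG, hf, Pi.smul_apply, smul_eq_mul, mul_assoc] at h
      rw [h, integral_const_mul]
    have hDint := hsq (hDm n) fun ω => hC (X (n + 1) ω) (X n ω)
    have hMsq := hsq (hMm n) (hMle n)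
    have hexp : ∀ ω, (∑ k ∈ Finset.range (n + 1), (f (X (k + 1) ω) - q * f (X k ω))) ^ 2
        = M ω ^ 2 + 2 * (f (X (n + 1) ω) * M ω - q * (f (X n ω) * M ω))
          + (f (X (n + 1) ω) - q * f (X n ω)) ^ 2 := fun ω => by
      rw [Finset.sum_range_succ]
      ring
    have hc1 : Integrable
        (fun ω => 2 * (f (X (n + 1) ω) * M ω - q * (f (X n ω) * M ω))) P :=
      ((hmul _).sub ((hmul _).const_mul q)).const_mul 2
    have hc2 : Integrable
        (fun ω => M ω ^ 2 + 2 * (f (X (n + 1) ω) * M ω - q * (f (X n ω) * M ω))) P :=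
      hMsq.add hc1
    simp_rw [hexp]
    rw [integral_add hc2 hDint, integral_add hMsq hc1, integral_const_mul,
      integral_sub (hmul _) ((hmul _).const_mul q), integral_const_mul, hcross, sub_self, mul_zero,
      add_zero]
    have hD : ∫ ω, (f (X (n + 1) ω) - q * f (X n ω)) ^ 2 ∂P ≤ C ^ 2 := by
      refine (integral_mono hDint (integrable_const (C ^ 2)) fun ω => ?_).trans (by simp)
      have := abs_le.1 (hC (X (n + 1) ω) (X n ω))
      exact sq_le_sq' this.1 this.2
    push_cast
    linarith

/-- Sums of an eigenfunction with eigenvalue different from `1` are negligible: they differ from a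
multiple of the martingale of `IsMarkovChain.integral_sq_sum_le` by boundary terms. -/
theorem IsMarkovChain.ae_tendsto_sum_eigenfunction_div_sq (hX : IsMarkovChain p X P) {f : E → ℝ}
    {q : ℝ} (hf : p *ᵥ f = q • f) (hq : q ≠ 1) :
    ∀ᵐ ω ∂P, Tendsto (fun n : ℕ => (∑ k ∈ Finset.Icc 1 (n ^ 2), f (X k ω)) / (n ^ 2 : ℕ)) atTop
      (𝓝 0) := by
  obtain ⟨B, hB⟩ : ∃ B, ∀ x, |f x| ≤ B :=
    ⟨∑ x, |f x|, fun x => Finset.single_le_sum (fun i _ => abs_nonneg (f i)) (Finset.mem_univ x)⟩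
  have hC : ∀ x y, |f x - q * f y| ≤ B + |q| * B := fun x y => by
    refine (abs_sub _ _).trans ?_
    rw [abs_mul]
    gcongr <;> exact hB _
  have hfm : ∀ k, Measurable fun ω => f (X k ω) := fun k =>
    (measurable_of_countable f).comp (hX.measurable k)
  set M : ℕ → Ω → ℝ := fun n ω => ∑ k ∈ Finset.range n, (f (X (k + 1) ω) - q * f (X k ω)) with hM
  have hMm : ∀ n, Measurable (M n) := fun n =>
    Finset.measurable_fun_sum _ fun k _ => (hfm _).sub ((hfm _).const_mul q)
  have hMle : ∀ n ω, |M n ω| ≤ n * (B + |q| * B) := fun n ω =>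
    (Finset.abs_sum_le_sum_abs _ _).trans
      ((Finset.sum_le_card_nsmul _ _ _ fun k _ => hC _ _).trans (by simp [mul_add]))
  have hlint : ∀ n : ℕ, ∫⁻ ω, ENNReal.ofReal (M n ω ^ 2) ∂P
      ≤ ENNReal.ofReal ((B + |q| * B) ^ 2 * n) := fun n => by
    rw [← ofReal_integral_eq_lintegral_ofReal]
    · exact ENNReal.ofReal_le_ofReal (hX.integral_sq_sum_le hf hC n)
    · refine Integrable.of_bound ((hMm n).pow_const 2).aestronglyMeasurable
        ((n * (B + |q| * B)) ^ 2) (Eventually.of_forall fun ω => ?_)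
      rw [Real.norm_of_nonneg (sq_nonneg _)]
      have := abs_le.1 (hMle n ω)
      exact sq_le_sq' this.1 this.2
    · exact Eventually.of_forall fun ω => sq_nonneg _
  filter_upwards [ae_tendsto_div_sq hMm hlint] with ω hω
  have hq' : 1 - q ≠ 0 := sub_ne_zero.2 hq.symm
  have hid : ∀ n : ℕ, ∑ k ∈ Finset.Icc 1 n, f (X k ω)
      = (1 - q)⁻¹ * (M n ω - q * (f (X n ω) - f (X 0 ω))) := fun n => by
    rw [eq_inv_mul_iff_mul_eq₀ hq']
    induction n with
    | zero => simp [hM]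
    | succ n ih =>
      rw [Finset.sum_Icc_succ_top (by omega), mul_add, ih]
      simp only [hM, Finset.sum_range_succ]
      ring
  have hbdry : Tendsto (fun n : ℕ => q * (f (X (n ^ 2) ω) - f (X 0 ω)) / (n ^ 2 : ℕ)) atTop
      (𝓝 0) := by
    have hinv : Tendsto (fun n : ℕ => (((n ^ 2 : ℕ) : ℝ))⁻¹) atTop (𝓝 0) :=
      (tendsto_inv_atTop_nhds_zero_nat (𝕜 := ℝ)).comp (tendsto_pow_atTop two_ne_zero)
    have hbd : IsBoundedUnder (· ≤ ·) atTop
        fun n : ℕ => ‖q * (f (X (n ^ 2) ω) - f (X 0 ω))‖ := by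
      refine isBoundedUnder_of ⟨|q| * (B + B), fun n => ?_⟩
      rw [norm_mul, Real.norm_eq_abs, Real.norm_eq_abs]
      gcongr
      exact (abs_sub _ _).trans (add_le_add (hB _) (hB _))
    simpa [div_eq_mul_inv] using hbd.smul_tendsto_zero hinv
  have h := (hω.sub hbdry).const_mul (1 - q)⁻¹
  simp only [sub_zero, mul_zero] at h
  refine h.congr fun n => ?_
  rw [hid]
  ring

end General

theorem pos_of_isIrreducible_two {p : Matrix (Fin 2) (Fin 2) ℝ} (hp : p.IsIrreducible) :
    0 < p 0 1 := by
  have hnn : 0 ≤ p 0 1 := hp.nonneg 0 1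
  refine lt_of_le_of_ne hnn fun h => ?_
  have hpow : ∀ k, (p ^ k) 0 1 = 0 := fun k => by
    induction k with
    | zero => simp
    | succ k ih => rw [pow_succ, Matrix.mul_apply, Fin.sum_univ_two, ih, ← h]; simp
  obtain ⟨k, -, hk⟩ := (Matrix.isIrreducible_iff_exists_pow_pos hp.nonneg).1 hp 0 1
  exact hk.ne' (hpow k)

/-- **Law of large numbers for the two-state chain.** The centred function is an eigenfunction of
the transition matrix, with eigenvalue `1 - p 0 1 - p 1 0`. -/
theorem ae_tendsto_two_state_sum_div {p : Matrix (Fin 2) (Fin 2) ℝ} {X : ℕ → Ω → Fin 2}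
    (hX : IsMarkovChain p X P) (hp : p.IsIrreducible) {π : Fin 2 → ℝ}
    (hπ : IsStationaryDistribution p π) (a : Fin 2 → ℝ) :
    ∀ᵐ ω ∂P, Tendsto (fun n : ℕ => (∑ k ∈ Finset.Icc 1 n, a (X k ω)) / n) atTop
      (𝓝 (a 0 * π 0 + a 1 * π 1)) := by
  set m := a 0 * π 0 + a 1 * π 1 with hm
  have hα := pos_of_isIrreducible_two hp
  have hβ : 0 ≤ p 1 0 := hp.nonneg 1 0
  have hrow0 : p 0 0 + p 0 1 = 1 := by
    simpa using Matrix.sum_row_of_mem_rowStochastic hX.stochastic 0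
  have hrow1 : p 1 0 + p 1 1 = 1 := by
    simpa using Matrix.sum_row_of_mem_rowStochastic hX.stochastic 1
  have hsum : π 0 + π 1 = 1 := by simpa using hπ.1.2
  have hbal : π 0 * p 0 1 + π 1 * p 1 1 = π 1 := by
    simpa [Matrix.vecMul, dotProduct] using congrFun hπ.2 1
  have hbal' : π 0 * p 0 1 = π 1 * p 1 0 := by
    linear_combination hbal - π 1 * hrow1
  have hπ0 : π 0 = 1 - π 1 := by linarith
  have hkey : π 1 * (p 0 1 + p 1 0) = p 0 1 := by
    rw [hπ0] at hbal'
    linear_combination -hbal'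
  have heig : (p *ᵥ fun x => a x - m) = (1 - p 0 1 - p 1 0) • fun x => a x - m := by
    have h00 : p 0 0 = 1 - p 0 1 := by linarith
    have h11 : p 1 1 = 1 - p 1 0 := by linarith
    ext i
    fin_cases i
    · simp only [Matrix.mulVec, dotProduct, Fin.sum_univ_two, Fin.zero_eta, Pi.smul_apply,
        smul_eq_mul, h00, hm, hπ0]
      linear_combination (a 0 - a 1) * hkey
    · simp only [Matrix.mulVec, dotProduct, Fin.sum_univ_two, Fin.mk_one, Pi.smul_apply,
        smul_eq_mul, h11, hm, hπ0]
      linear_combination (a 0 - a 1) * hkey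
  filter_upwards [hX.ae_tendsto_sum_eigenfunction_div_sq heig (by linarith)] with ω hω
  -- Adding a constant `K` that dominates `a` makes the partial sums monotone.
  set K := |a 0| + |a 1| with hK
  have hKa : ∀ x, 0 ≤ a x + K := fun x => by
    have h0 := abs_nonneg (a 0)
    have h1 := abs_nonneg (a 1)
    have h2 := neg_abs_le (a 0)
    have h3 := neg_abs_le (a 1)
    fin_cases x
    · simp only [hK, Fin.zero_eta]; linarith
    · simp only [hK, Fin.mk_one]; linarith
  set u : ℕ → ℝ := fun n => ∑ k ∈ Finset.Icc 1 n, (a (X k ω) + K) with hu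
  have humono : Monotone u := fun n n' h =>
    Finset.sum_le_sum_of_subset_of_nonneg (Finset.Icc_subset_Icc_right h) fun k _ _ => hKa _
  have husq : Tendsto (fun n : ℕ => u (n ^ 2) / (n ^ 2 : ℕ)) atTop (𝓝 (0 + (m + K))) := by
    refine (hω.add_const (m + K)).congr' ?_
    filter_upwards [eventually_gt_atTop 0] with n hn
    have hn2 : ((n ^ 2 : ℕ) : ℝ) ≠ 0 := by positivity
    rw [div_add' _ _ _ hn2]
    congr 1
    simp only [hu, Finset.sum_add_distrib, Finset.sum_sub_distrib, Finset.sum_const,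
      Nat.card_Icc, Nat.add_sub_cancel, nsmul_eq_mul]
    ring
  have h := (tendsto_div_of_tendsto_div_sq humono husq).sub_const K
  rw [zero_add, add_sub_cancel_right] at h
  refine h.congr' ?_
  filter_upwards [eventually_gt_atTop 0] with n hn
  have hn' : (n : ℝ) ≠ 0 := by positivity
  rw [div_sub' hn']
  congr 1
  simp only [hu, Finset.sum_add_distrib, Finset.sum_const, Nat.card_Icc, Nat.add_sub_cancel,
    nsmul_eq_mul]
  ring

end MarkovChain

/-! ### Composition of the two laws of large numbers -/

theorem exists_abs_sub_le_of_tendsto_div {u : ℕ → ℝ} {l : ℝ}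
    (hu : Tendsto (fun n : ℕ => u n / n) atTop (𝓝 l)) {ε : ℝ} (hε : 0 < ε) :
    ∃ C, 0 ≤ C ∧ ∀ n : ℕ, |u n - l * n| ≤ ε * n + C := by
  obtain ⟨n₀, hn₀⟩ := eventually_atTop.1
    ((Metric.tendsto_nhds.1 hu ε hε).and (eventually_gt_atTop 0))
  refine ⟨∑ n ∈ Finset.range n₀, |u n - l * n|, Finset.sum_nonneg fun _ _ => abs_nonneg _,
    fun n => ?_⟩
  rcases lt_or_ge n n₀ with h | h
  · have := Finset.single_le_sum (f := fun n : ℕ => |u n - l * n|)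
      (fun i _ => abs_nonneg _) (Finset.mem_range.2 h)
    have h2 : 0 ≤ ε * n := by positivity
    linarith
  · obtain ⟨h1, h2⟩ := hn₀ n h
    have hn : (0 : ℝ) < n := by exact_mod_cast h2
    rw [Real.dist_eq, div_sub' hn.ne', abs_div, abs_of_pos hn, div_lt_iff₀ hn] at h1
    have h3 : 0 ≤ ∑ n ∈ Finset.range n₀, |u n - l * n| :=
      Finset.sum_nonneg fun _ _ => abs_nonneg _
    rw [mul_comm l]
    linarith

/-- For a nondecreasing path the law of large numbers at integer times extends to all times. -/
theorem exists_abs_sub_le_of_monotone {c : ℝ≥0 → ℕ} (hc : Monotone c) {ρ : ℝ} (hρ : 0 ≤ ρ)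
    (h : Tendsto (fun n : ℕ => (c n : ℝ) / n) atTop (𝓝 ρ)) {ε : ℝ} (hε : 0 < ε) :
    ∃ C, 0 ≤ C ∧ ∀ s : ℝ≥0, |(c s : ℝ) - ρ * s| ≤ ε * s + C := by
  obtain ⟨C, hC, H⟩ := exists_abs_sub_le_of_tendsto_div h hε
  refine ⟨C + ρ + ε, by positivity, fun s => ?_⟩
  have h1 : (⌊s⌋₊ : ℝ≥0) ≤ s := Nat.floor_le zero_le
  have h2 : s ≤ ((⌊s⌋₊ + 1 : ℕ) : ℝ≥0) := by exact_mod_cast (Nat.lt_floor_add_one s).le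
  have h3 : (c ⌊s⌋₊ : ℝ) ≤ c s := by exact_mod_cast hc h1
  have h4 : (c s : ℝ) ≤ c (⌊s⌋₊ + 1 : ℕ) := by exact_mod_cast hc h2
  have h1' : (⌊s⌋₊ : ℝ) ≤ s := by exact_mod_cast h1
  have h2' : (s : ℝ) ≤ ⌊s⌋₊ + 1 := by exact_mod_cast h2
  have h5 := (abs_le.1 (H ⌊s⌋₊)).1
  have h6 := (abs_le.1 (H (⌊s⌋₊ + 1))).2
  push_cast at h4 h5 h6
  rw [abs_le]
  constructor <;> nlinarith

/-- If `A m ≈ m * a` for large `m` and `c s ≈ ρ * s` for large `s`, then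
`(x + A (c (n * t))) / n ≈ a * ρ * t`, uniformly for `t` in a bounded interval. -/
theorem eventually_forall_abs_comp_div_sub_lt {A : ℕ → ℝ} {a : ℝ}
    (hA : Tendsto (fun n : ℕ => A n / n) atTop (𝓝 a)) {c : ℝ≥0 → ℕ} (hc : Monotone c) {ρ : ℝ}
    (hρ : 0 ≤ ρ) (h : Tendsto (fun n : ℕ => (c n : ℝ) / n) atTop (𝓝 ρ)) (x : ℝ) (T : ℝ≥0) {ε : ℝ}
    (hε : 0 < ε) :
    ∀ᶠ n : ℕ in atTop, ∀ t ≤ T, |(x + A (c (n * t))) / n - a * ρ * t| < ε := by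
  -- The total error is at most `δ * (ρ + δ + |a|) * T + K / n`, and `δ * (ρ + 1 + |a|) * T ≤ ε / 2`.
  set D : ℝ := (ρ + 1 + |a|) * (T + 1) with hD
  have hTnn : (0 : ℝ) ≤ T := T.2
  have hDpos : 0 < D := by positivity
  set δ : ℝ := min 1 (ε / (2 * D)) with hδdef
  have hδ : 0 < δ := by positivity
  have hδ1 : δ ≤ 1 := min_le_left _ _
  have hδD : δ * D ≤ ε / 2 := by
    have : δ ≤ ε / (2 * D) := min_le_right _ _
    rw [le_div_iff₀ (by positivity)] at this
    linarith
  obtain ⟨C₁, hC₁, H₁⟩ := exists_abs_sub_le_of_tendsto_div hA hδ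
  obtain ⟨C₂, hC₂, H₂⟩ := exists_abs_sub_le_of_monotone hc hρ h hδ
  set K : ℝ := |x| + δ * C₂ + C₁ + |a| * C₂ with hK
  have hKlim : Tendsto (fun n : ℕ => K / n) atTop (𝓝 0) := tendsto_const_div_atTop_nhds_zero_nat K
  filter_upwards [hKlim.eventually (gt_mem_nhds (half_pos hε)), eventually_gt_atTop 0]
    with n hn hn0 t ht
  have hn' : (0 : ℝ) < n := by exact_mod_cast hn0
  have htT : (t : ℝ) ≤ T := by exact_mod_cast ht
  have ht0 : (0 : ℝ) ≤ t := t.2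
  have h1 := H₁ (c (n * t))
  have h2 := H₂ (n * t)
  push_cast at h2
  have h3 : (c (n * t) : ℝ) ≤ (ρ + δ) * (n * t) + C₂ := by
    have := (abs_le.1 h2).2
    linarith
  have hsplit : (x + A (c (n * t))) / n - a * ρ * t
      = (x + (A (c (n * t)) - a * c (n * t)) + a * (c (n * t) - ρ * (n * t))) / n := by
    field_simp
    ring
  have hnum : |x + (A (c (n * t)) - a * c (n * t)) + a * (c (n * t) - ρ * (n * t))|
      ≤ δ * (ρ + δ + |a|) * (n * t) + K := by
    have h4 : |a * ((c (n * t) : ℝ) - ρ * (n * t))| ≤ |a| * (δ * (n * t) + C₂) := by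
      rw [abs_mul]
      gcongr
    have h5 := mul_le_mul_of_nonneg_left h3 hδ.le
    refine (abs_add_three _ _ _).trans ?_
    rw [hK]
    linarith
  have hlin : δ * (ρ + δ + |a|) * (n * t) ≤ δ * D * n := by
    have h6 : (ρ + δ + |a|) * t ≤ D := by
      rw [hD]
      gcongr
      linarith
    have := mul_le_mul_of_nonneg_left (mul_le_mul_of_nonneg_right h6 hn'.le) hδ.le
    linarith
  rw [hsplit, abs_div, abs_of_pos hn']
  calc _ ≤ (δ * D * n + K) / n := by
        gcongr
        exact hnum.trans (by linarith)
    _ = δ * D + K / n := by field_simp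
    _ < ε := by linarith

section Composition

variable {Ω : Type*} [MeasurableSpace Ω] {N : ℝ≥0 → Ω → ℕ} {E : Type*} [MeasurableSpace E]

theorem measurable_midPrice (hN : IsCountingProcess N) {S₀ : Ω → ℝ} (hS₀ : Measurable S₀)
    {a : E → ℝ} (ha : Measurable a) {X : ℕ → Ω → E} (hX : ∀ k, Measurable (X k)) (t : ℝ≥0) :
    Measurable fun ω => midPrice S₀ a X N t ω := by
  have h : Measurable fun q : ℕ × Ω => ∑ k ∈ Finset.Icc 1 q.1, a (X k q.2) :=
    measurable_from_prod_countable_right fun m =>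
      Finset.measurable_fun_sum (Finset.Icc 1 m) fun k _ => ha.comp (hX k)
  exact hS₀.add (h.comp ((hN.measurable t).prodMk measurable_id))

theorem measurable_scaledMidPrice (hN : IsCountingProcess N) {S₀ : Ω → ℝ} (hS₀ : Measurable S₀)
    {a : E → ℝ} (ha : Measurable a) {X : ℕ → Ω → E} (hX : ∀ k, Measurable (X k)) (n : ℕ) :
    Measurable (scaledMidPrice hN S₀ a X n) := by
  refine SkorokhodSpace.measurable_of_measurable_apply
    (fun t => (measurable_midPrice hN hS₀ ha hX _).div_const _) fun ω => ?_
  have hmono : Monotone fun s : ℝ≥0 => (n : ℝ≥0) * s := fun _ _ h => mul_le_mul_right h _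
  refine ⟨fun t => N (n * t) ω, fun m => (S₀ ω + ∑ k ∈ Finset.Icc 1 m, a (X k ω)) / n,
    (hN.mono ω).comp hmono, fun t => ?_, fun t => rfl⟩
  exact (hN.rightContinuous ω (n * t)).comp
    (continuous_const.mul continuous_id).continuousWithinAt fun s hs => hmono hs

/-- Laws of large numbers for the jump sizes and for the counting process combine to one for the
compound process, as a process. -/
theorem tendstoInDistribution_scaledMidPrice {P : Measure Ω} [IsProbabilityMeasure P]
    (hN : IsCountingProcess N) {S₀ : Ω → ℝ} (hS₀ : Measurable S₀) {a : E → ℝ} (ha : Measurable a)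
    {X : ℕ → Ω → E} (hX : ∀ k, Measurable (X k)) {m ρ : ℝ} (hρ : 0 ≤ ρ)
    (hXlim : ∀ᵐ ω ∂P, Tendsto (fun n : ℕ => (∑ k ∈ Finset.Icc 1 n, a (X k ω)) / n) atTop (𝓝 m))
    (hNlim : ∀ᵐ ω ∂P, Tendsto (fun n : ℕ => (N n ω : ℝ) / n) atTop (𝓝 ρ)) :
    TendstoInDistribution (fun n : ℕ => scaledMidPrice hN S₀ a X n) atTop
      (fun _ : Ω => linearPath (m * ρ)) (fun _ => P) P := by
  refine tendstoInDistribution_of_ae_tendsto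
    (fun n => (measurable_scaledMidPrice hN hS₀ ha hX n).aemeasurable) aemeasurable_const ?_
  filter_upwards [hXlim, hNlim] with ω h1 h2
  refine SkorokhodSpace.tendsto_nhds_of_locally_uniform fun T ε hε => ?_
  exact eventually_forall_abs_comp_div_sub_lt h1 (hN.mono ω) hρ h2 (S₀ ω) T hε

end Composition

theorem mainTheorem7 {Ω : Type*} [MeasurableSpace Ω] (P : Measure Ω) [IsProbabilityMeasure P]
    (lam : ℝ) (hlam : 0 < lam)
    (μ : ℝ → ℝ) (hμ_meas : Measurable μ) (hμ_nonneg : ∀ t, 0 ≤ t → 0 ≤ μ t)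
    (hμ_int : IntegrableOn μ (Set.Ioi 0))
    (hμ_pos : 0 < ∫ s in Set.Ioi 0, μ s) (hμ_lt : (∫ s in Set.Ioi 0, μ s) < 1)
    (N : ℝ≥0 → Ω → ℕ) (hN : IsHawkesProcess lam μ N P)
    (p : Matrix (Fin 2) (Fin 2) ℝ) (X : ℕ → Ω → Fin 2) (hX : IsMarkovChain p X P)
    (hp : p.IsIrreducible)
    (hXN : IndepFun (fun ω k => X k ω) (fun ω t => N t ω) P)
    (π : Fin 2 → ℝ) (hπ : IsStationaryDistribution p π)
    (S₀ : Ω → ℝ) (hS₀ : Measurable S₀) :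
    (∀ a : Fin 2 → ℝ,
      TendstoInDistribution (fun n : ℕ => scaledMidPrice hN.counting S₀ a X n) atTop
        (fun _ : Ω => linearPath
          ((a 0 * π 0 + a 1 * π 1) * (lam / (1 - ∫ s in Set.Ioi 0, μ s))))
        (fun _ => P) P) ∧
    (∀ (δ : ℝ) (Y : ℕ → Ω → ℝ), 0 < δ → (∀ k ω, Y k ω = if X k ω = 0 then δ else -δ) →
      TendstoInDistribution (fun n : ℕ => scaledMidPrice hN.counting S₀ id Y n) atTop
        (fun _ : Ω => linearPath
          (δ * (2 * π 0 - 1) * (lam / (1 - ∫ s in Set.Ioi 0, μ s))))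
        (fun _ => P) P) := by
  have hρ : 0 ≤ lam / (1 - ∫ s in Set.Ioi 0, μ s) := div_nonneg hlam.le (by linarith)
  have hNlim := ae_tendsto_hawkes_div hN hlam.le hμ_nonneg hμ_int hμ_pos hμ_lt
  have hXm := hX.measurable
  refine ⟨fun a => tendstoInDistribution_scaledMidPrice hN.counting hS₀
    (measurable_of_countable a) hXm hρ (ae_tendsto_two_state_sum_div hX hp hπ a) hNlim, ?_⟩
  intro δ Y _ hY
  set a : Fin 2 → ℝ := fun x => if x = 0 then δ else -δ with ha
  have hYa : ∀ k ω, Y k ω = a (X k ω) := hY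
  have hYm : ∀ k, Measurable (Y k) := fun k => by
    have : Y k = a ∘ X k := funext fun ω => hYa k ω
    rw [this]
    exact (measurable_of_countable a).comp (hXm k)
  have hsum : π 0 + π 1 = 1 := by simpa using hπ.1.2
  have hlim : a 0 * π 0 + a 1 * π 1 = δ * (2 * π 0 - 1) := by
    simp only [ha, if_true, one_ne_zero, if_false]
    linear_combination -δ * hsum
  refine tendstoInDistribution_scaledMidPrice hN.counting hS₀ measurable_id hYm hρ ?_ hNlim
  rw [← hlim]
  simp only [id, hYa]
  exact ae_tendsto_two_state_sum_div hX hp hπ a
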